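/- For $p\in(0,1)$ and $n\ge 1$, the stationary continuous-time $p$-biased random walk on $\{0,1\}^n$ is the process $(X_t)_{t\ge 0}$ whose coordinates are independent and such that each coordinate has a rate one Poisson clock, at each ring of which it is assigned a new value drawn, independently of everything else, from $(1-p)\delta_0+p\,\delta_1$; the initial values $X_0(1),\dots,X_0(n)$ are i.i.d. with this same distribution and independent of the clocks and of the later draws. Let $(p_n)_{n\ge 1}$ be a decreasing (not necessarily strictly) sequence in $(0,1)$ such that (A) $\lim_{n\to\infty} np_n=\infty$; (B) $\lim_{n\to\infty} np_n^r=0$ for some real $r\ge 2$; (C) for every map $\phi:\{1,2,\dots\}\to\{1,2,\dots\}$ with $\lim_{n\to\infty}|n-\phi(n)|/\min(n,\phi(n))=0$ one has $\lim_{n\to\infty}p_n/p_{\phi(n)}=1$. For each $n$ let $X^{(n)}$ be the stationary continuous-time $p_n$-biased random walk on $\{0,1\}^n$, and for $f_n:\{0,1\}^n\to\{0,1\}$ let $$C_n=\lim_{M\to\infty}\sum_{j=0}^{M-1}\mathbf 1\bigl(f_n(X^{(n)}_{j/M})\ne f_n(X^{(n)}_{(j+1)/M})\bigr)$$ be the number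 of times in $(0,1)$ at which $f_n(X^{(n)}_t)$ changes its value (the limit exists almost surely). Then there are an infinite set $\mathcal N$ of positive integers and Boolean functions $f_n:\{0,1\}^n\to\{0,1\}$, $n\in\mathcal N$, such that (all limits being taken along $n\in\mathcal N$) (a) $(f_n)$ is non-degenerate: $0<\liminf_{n\to\infty}P(f_n(X^{(n)}_0)=1)\le\limsup_{n\to\infty}P(f_n(X^{(n)}_0)=1)<1$; (b) each $f_n$ is transitive: for all $i,j\in\{1,\dots,n\}$ there is a permutation $\sigma$ of $\{1,\dots,n\}$ with $\sigma(i)=j$ and $f_n\bigl((x(\sigma(k)))_{1\le k\le n}\bigr)=f_n(x)$ for all $x\in\{0,1\}^n$; (c) $(f_n)$ is tame: for every $\varepsilon>0$ there are $k\ge 1$ and $n_0\ge 1$ such that $P(C_n\ge k)<\varepsilon$ for all $n\in\mathcal N$ with $n\ge n_0$; (d) $\lim_{n\to\infty}\mathbb E[C_n]=\infty$. -/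

import Mathlib

open MeasureTheory ProbabilityTheory Filter Topology
open scoped NNReal ENNReal

/-- A rate one Poisson process `N` on `[0, ∞)`: almost surely `N` starts at `0` and has monotone,
right-continuous paths; the increments are independent and, for `s ≤ t`, the increment
`N t - N s` is Poisson distributed with mean `t - s`. (The subtraction takes place in `ℕ`, but it
is not truncated, since the paths are almost surely monotone.) -/
structure IsRateOnePoissonProcess {Ω : Type*} [MeasurableSpace Ω] (P : Measure Ω)
    (N : ℝ≥0 → Ω → ℕ) : Prop where
  measurable : ∀ t, Measurable (N t)
  paths : ∀ᵐ ω ∂P, N 0 ω = 0 ∧ Monotone (fun t ↦ N t ω) ∧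
    ∀ t, ContinuousWithinAt (fun t ↦ N t ω) (Set.Ici t) t
  indepIncrements : HasIndepIncrements N P
  law_increment : ∀ s t, s ≤ t →
    HasLaw (fun ω ↦ N t ω - N s ω) (poissonMeasure (t - s)) P

/-- `X` is (a realization, on the probability space `(Ω, P)`, of) the stationary continuous time
`p`-biased random walk on `{0,1}^n`. The coordinates are independent; coordinate `i` has a rate one
Poisson clock `N i` and, independently of the clock, i.i.d. values `ξ i 0, ξ i 1, …` with
distribution `(1 - p) δ₀ + p δ₁`. It starts from `ξ i 0`, and at the `k`-th ring of its clock it is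
assigned the new value `ξ i k`. -/
def IsBiasedWalk {n : ℕ} (p : ℝ) {Ω : Type*} [MeasurableSpace Ω] (P : Measure Ω)
    (X : ℝ≥0 → Ω → Fin n → Bool) : Prop :=
  ∃ (N : Fin n → ℝ≥0 → Ω → ℕ) (ξ : Fin n → ℕ → Ω → Bool),
    (∀ i, IsRateOnePoissonProcess P (N i)) ∧
    (∀ i k, Measurable (ξ i k)) ∧
    (∀ i k, P {ω | ξ i k ω = true} = ENNReal.ofReal p) ∧
    (∀ i, iIndepFun (ξ i) P) ∧
    (∀ i, IndepFun (fun ω t ↦ N i t ω) (fun ω k ↦ ξ i k ω) P) ∧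
    iIndepFun (fun i ω ↦ ((fun t ↦ N i t ω, fun k ↦ ξ i k ω) : (ℝ≥0 → ℕ) × (ℕ → Bool))) P ∧
    ∀ t ω i, X t ω i = ξ i (N i t ω) ω

/-- The number of value changes in `(0,1)` of a path `y` with values in `{0,1}`: the limit, as
`M → ∞`, of the number of `j < M` with `y (j / M) ≠ y ((j + 1) / M)`. The limit exists for every
right-continuous path with finitely many jumps in `(0,1]`, hence almost surely for the paths
considered here; writing it as a `liminf` makes the definition total. -/
noncomputable def numChanges (y : ℝ≥0 → Bool) : ℝ≥0∞ :=
  liminf (fun M : ℕ ↦ ∑ j ∈ Finset.range M,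
    if y ((j : ℝ≥0) / M) ≠ y (((j : ℝ≥0) + 1) / M) then (1 : ℝ≥0∞) else 0) atTop

/-- The random variable `C(f)`: the number of value changes of `f (X t)` for `t` in `(0,1)`. -/
noncomputable def changeCount {n : ℕ} {Ω : Type*} (X : ℝ≥0 → Ω → Fin n → Bool)
    (f : (Fin n → Bool) → Bool) (ω : Ω) : ℝ≥0∞ :=
  numChanges (fun t ↦ f (X t ω))

/-- A Boolean function is transitive if any coordinate can be moved to any other one by a
permutation of the coordinates that leaves the function invariant. -/
def IsTransitiveBoolFun {n : ℕ} (f : (Fin n → Bool) → Bool) : Prop :=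
  ∀ i j : Fin n, ∃ σ : Equiv.Perm (Fin n), σ i = j ∧ ∀ x, f (fun k ↦ x (σ k)) = f x

section Sequences

/- Throughout, `ν 0 < ν 1 < …` enumerates the index set, `f i` is the Boolean function on
`{0,1}^(ν i)`, and `X n` is the walk on `{0,1}^n`, realized on `(Ω n, P n)`. -/

/-- The sequence is non-degenerate: the probabilities `P (f_n (X_0) = 1)` are bounded away from
`0` and `1` in the limit. -/
def IsNondegenerateSeq (ν : ℕ → ℕ) (f : ∀ i, (Fin (ν i) → Bool) → Bool)
    {Ω : ℕ → Type*} [∀ n, MeasurableSpace (Ω n)] (P : ∀ n, Measure (Ω n))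
    (X : ∀ n, ℝ≥0 → Ω n → Fin n → Bool) : Prop :=
  0 < liminf (fun i ↦ P (ν i) {ω | f i (X (ν i) 0 ω) = true}) atTop ∧
    limsup (fun i ↦ P (ν i) {ω | f i (X (ν i) 0 ω) = true}) atTop < 1

/-- The sequence is tame: the numbers of value changes form a tight sequence. -/
def IsTameSeq (ν : ℕ → ℕ) (f : ∀ i, (Fin (ν i) → Bool) → Bool)
    {Ω : ℕ → Type*} [∀ n, MeasurableSpace (Ω n)] (P : ∀ n, Measure (Ω n))
    (X : ∀ n, ℝ≥0 → Ω n → Fin n → Bool) : Prop :=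
  ∀ ε : ℝ≥0∞, 0 < ε → ∃ k : ℕ, 1 ≤ k ∧ ∃ n₀ : ℕ, 1 ≤ n₀ ∧ ∀ i, n₀ ≤ ν i →
    P (ν i) {ω | (k : ℝ≥0∞) ≤ changeCount (X (ν i)) (f i) ω} < ε

end Sequences

/-! Tameness bounds the changes in probability, not in mean, so the idea is to hide very many
changes in an event of vanishing probability. Cut `n = B * s` coordinates into `B` blocks of size
`s`, choose `s` so that `B * (s * p) ^ r` is of order one, and ask whether some block has at least
`r` ones (`HasDenseBlock`). When some block has more than `r` ones, let the parity of all ones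
decide instead (`denseBlockParity`).

The block event alone is non-degenerate, and its expected number of changes in unit time is at most
`2 * r * B * (s * p) ^ r`, since a witnessing set of `r` ones must have had one of its sites
resampled. The exceptional event has probability at most `B * (s * p) ^ (r + 1)` at a fixed time,
and at most `r + 2` times this of occurring on a time grid in the unit interval. This is `O(s * p)`,
hence tends to `0`, so the modification affects neither non-degeneracy nor tameness.

The stationary probability of the exceptional event is still at least a constant times `s * p`.
While it holds, switching on any single coordinate changes the function, and this happens at rate
about `n * p`. So the mean number of changes is at least of order `(n * p) * (s * p)`, which must
tend to infinity.

For the parameters take `r = m + 1` with `m ≥ 2` and `n * p ^ (m + 1) → 0`. Then `n * p ^ (m + 1) *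
s ^ m ≍ 1` determines `s`, and `(n p · s p) ^ m = (n p ^ (m + 1) s ^ m) (n p) ^ (m - 1) → ∞`.
Rounding `n` down to a multiple of `s n` is harmless by the regularity hypothesis on `p`. The main
estimates are `measure_le_changeCount_le`, `le_lintegral_changeCount` and `exists_block_parameters`.
-/

/-! ### Counting changes on finite time grids -/

/-- The number of value changes of `y` seen along the grid `0, 1/M, …, 1`. -/
noncomputable def gridChanges (M : ℕ) (y : ℝ≥0 → Bool) : ℕ :=
  ∑ j ∈ Finset.range M, if y ((j : ℝ≥0) / M) ≠ y (((j : ℝ≥0) + 1) / M) then 1 else 0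

lemma numChanges_eq (y : ℝ≥0 → Bool) :
    numChanges y = liminf (fun M : ℕ ↦ (gridChanges M y : ℝ≥0∞)) atTop := by
  unfold numChanges gridChanges
  congr 1
  ext M
  push_cast
  rfl

/-- The grid counts are integers, so a `liminf` that is at least `k` exceeds `k - 1`, and then the
counts are eventually at least `k`. -/
lemma natCast_le_numChanges_iff (k : ℕ) (y : ℝ≥0 → Bool) :
    (k : ℝ≥0∞) ≤ numChanges y ↔ ∀ᶠ M in atTop, k ≤ gridChanges M y := by
  rw [numChanges_eq]
  constructor
  · intro h
    rcases Nat.eq_zero_or_pos k with rfl | hk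
    · simp
    have h1 : ((k - 1 : ℕ) : ℝ≥0∞) < liminf (fun M : ℕ ↦ (gridChanges M y : ℝ≥0∞)) atTop :=
      lt_of_lt_of_le (by exact_mod_cast Nat.sub_lt hk one_pos) h
    filter_upwards [eventually_lt_of_lt_liminf h1] with M hM
    have : k - 1 < gridChanges M y := by exact_mod_cast hM
    omega
  · intro h
    refine le_liminf_of_le (by isBoundedDefault) ?_
    filter_upwards [h] with M hM
    exact_mod_cast hM

lemma ite_ne_le_sum_Ico (z : ℕ → Bool) {a b : ℕ} (hab : a ≤ b) :
    (if z a ≠ z b then 1 else 0) ≤ ∑ i ∈ Finset.Ico a b, if z i ≠ z (i + 1) then 1 else 0 := by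
  induction b, hab using Nat.le_induction with
  | base => simp
  | succ b hab ih =>
    rw [Finset.sum_Ico_succ_top hab]
    revert ih
    cases z a <;> cases z b <;> cases z (b + 1) <;> simp

/-- Two different values at the ends of an interval force a change inside it, so thinning a sequence
cannot create changes. -/
lemma sum_changes_subsequence_le (z : ℕ → Bool) {k : ℕ → ℕ} (hk : Monotone k) (m : ℕ) :
    (∑ j ∈ Finset.range m, if z (k j) ≠ z (k (j + 1)) then 1 else 0) ≤
      ∑ i ∈ Finset.Ico (k 0) (k m), if z i ≠ z (i + 1) then 1 else 0 := by
  induction m with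
  | zero => simp
  | succ m ih =>
    rw [Finset.sum_range_succ,
      ← Finset.sum_Ico_consecutive _ (hk (Nat.zero_le m)) (hk (Nat.le_succ m))]
    exact add_le_add ih (ite_ne_le_sum_Ico z (hk (Nat.le_succ m)))

/-- The values of a right-continuous path at finitely many grid points are seen on every
sufficiently fine grid. -/
lemma gridChanges_le_numChanges {y : ℝ≥0 → Bool}
    (hy : ∀ t, ContinuousWithinAt y (Set.Ici t) t) {m : ℕ} (hm : 0 < m) :
    (gridChanges m y : ℝ≥0∞) ≤ numChanges y := by
  rw [natCast_le_numChanges_iff]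
  -- Each `j / m` is rounded up to a multiple of `1 / M`. The rounded points approach `j / m` from
  -- the right, so right-continuity into the discrete space `Bool` makes the values agree for large
  -- `M`.
  let k : ℕ → ℕ → ℕ := fun M j ↦ ⌈(j : ℝ≥0) / m * M⌉₊
  have hmono : ∀ M, Monotone (k M) := fun M i j hij ↦ by
    refine Nat.ceil_mono ?_
    gcongr
  have hm' : (m : ℝ≥0) ≠ 0 := by exact_mod_cast hm.ne'
  have hlim : ∀ j, Tendsto (fun M ↦ (k M j : ℝ≥0) / M) atTop (𝓝[≥] ((j : ℝ≥0) / m)) := by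
    intro j
    refine tendsto_nhdsWithin_iff.2 ⟨?_, ?_⟩
    · have h1 : Tendsto (fun M : ℕ ↦ (j : ℝ≥0) / m + (M : ℝ≥0)⁻¹) atTop (𝓝 ((j : ℝ≥0) / m + 0)) :=
        tendsto_const_nhds.add (tendsto_inv_atTop_zero.comp tendsto_natCast_atTop_atTop)
      rw [add_zero] at h1
      refine tendsto_of_tendsto_of_tendsto_of_le_of_le' tendsto_const_nhds h1 ?_ ?_
      · filter_upwards [eventually_gt_atTop 0] with M hM
        have hM' : (0 : ℝ≥0) < M := by exact_mod_cast hM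
        exact (le_div_iff₀ hM').2 (Nat.le_ceil _)
      · filter_upwards [eventually_gt_atTop 0] with M hM
        have hM' : (0 : ℝ≥0) < M := by exact_mod_cast hM
        rw [div_le_iff₀ hM', add_mul, inv_mul_cancel₀ hM'.ne']
        exact (Nat.ceil_lt_add_one zero_le).le
    · filter_upwards [eventually_gt_atTop 0] with M hM
      have hM' : (0 : ℝ≥0) < M := by exact_mod_cast hM
      exact (le_div_iff₀ hM').2 (Nat.le_ceil _)
  have hval : ∀ j, ∀ᶠ M in atTop, y ((k M j : ℝ≥0) / M) = y ((j : ℝ≥0) / m) := fun j ↦ by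
    have := ((hy ((j : ℝ≥0) / m)).tendsto).comp (hlim j)
    rw [nhds_discrete, tendsto_pure] at this
    exact this
  have hall : ∀ᶠ M in atTop, ∀ j ∈ Finset.range (m + 1),
      y ((k M j : ℝ≥0) / M) = y ((j : ℝ≥0) / m) :=
    (Finset.eventually_all _).2 fun j _ ↦ hval j
  filter_upwards [hall] with M hM
  have h1 := sum_changes_subsequence_le (fun i ↦ y ((i : ℝ≥0) / M)) (hmono M) m
  have h0 : k M 0 = 0 := by simp [k]
  have hmM : k M m = M := by simp [k, div_self hm']
  rw [h0, hmM, ← Finset.range_eq_Ico] at h1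
  refine le_trans (le_of_eq ?_) (h1.trans (le_of_eq ?_))
  · refine Finset.sum_congr rfl fun j hj ↦ ?_
    have hj' := Finset.mem_range.1 hj
    have e1 := hM j (Finset.mem_range.2 (by omega))
    have e2 := hM (j + 1) (Finset.mem_range.2 (by omega))
    simp only [e1, e2, Nat.cast_add, Nat.cast_one]
  · simp [gridChanges]

/-! ### The walk at two times as a resampled pair -/

/-- The law of a `p`-biased walk at two times: `Y` and `Z` are vectors of independent
`p`-biased bits, and every bit of `Z` arises by resampling the one of `Y` with probability `ε`. -/
structure IsResampledPair {ι Ω : Type*} [MeasurableSpace Ω] (p ε : ℝ) (P : Measure Ω)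
    (Y Z : Ω → ι → Bool) : Prop where
  measurable_left : ∀ i, Measurable fun ω ↦ Y ω i
  measurable_right : ∀ i, Measurable fun ω ↦ Z ω i
  indep : iIndepFun (fun i ω ↦ (Y ω i, Z ω i)) P
  prob_left : ∀ i, P.real {ω | Y ω i = true} = p
  prob_right : ∀ i, P.real {ω | Z ω i = true} = p
  prob_up : ∀ i, P.real {ω | Y ω i = false ∧ Z ω i = true} = p * (1 - p) * ε
  prob_down : ∀ i, P.real {ω | Y ω i = true ∧ Z ω i = false} = p * (1 - p) * ε

lemma IsResampledPair.symm {ι Ω : Type*} [MeasurableSpace Ω] {p ε : ℝ} {P : Measure Ω}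
    {Y Z : Ω → ι → Bool} (h : IsResampledPair p ε P Y Z) : IsResampledPair p ε P Z Y where
  measurable_left := h.measurable_right
  measurable_right := h.measurable_left
  indep := h.indep.comp (fun _ ↦ Prod.swap) fun _ ↦ measurable_swap
  prob_left := h.prob_right
  prob_right := h.prob_left
  prob_up := fun i ↦ by simpa only [and_comm] using h.prob_down i
  prob_down := fun i ↦ by simpa only [and_comm] using h.prob_up i

section Coordinate

variable {Ω : Type*} [MeasurableSpace Ω] {P : Measure Ω}
  {N : ℝ≥0 → Ω → ℕ} {ξ : ℕ → Ω → Bool} {p : ℝ}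

/-- Decompose over the values of the clock at the two times: by independence of clock and draws,
each pair of indices in `A` contributes its probability times the same constant `c`. -/
lemma measure_sampled_eq (hN : ∀ t, Measurable (N t)) (hm : ∀ k, Measurable (ξ k))
    (hind : IndepFun (fun ω t ↦ N t ω) (fun ω k ↦ ξ k ω) P)
    {c : ℝ≥0∞} {A : Set (ℕ × ℕ)} {a b : Bool} (s t : ℝ≥0)
    (hc : ∀ k l, (k, l) ∈ A → P {ω | ξ k ω = a ∧ ξ l ω = b} = c) :
    P {ω | (N s ω, N t ω) ∈ A ∧ ξ (N s ω) ω = a ∧ ξ (N t ω) ω = b} =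
      P {ω | (N s ω, N t ω) ∈ A} * c := by
  have hpair : Measurable fun ω ↦ (N s ω, N t ω) := (hN s).prodMk (hN t)
  have hset : ∀ k l, MeasurableSet {ω | ξ k ω = a ∧ ξ l ω = b} := fun k l ↦
    (measurableSet_eq_fun (hm k) measurable_const).inter
      (measurableSet_eq_fun (hm l) measurable_const)
  have hdec : {ω | (N s ω, N t ω) ∈ A ∧ ξ (N s ω) ω = a ∧ ξ (N t ω) ω = b} =
      ⋃ q ∈ A, ((fun ω ↦ (N s ω, N t ω)) ⁻¹' {q} ∩ {ω | ξ q.1 ω = a ∧ ξ q.2 ω = b}) := by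
    ext ω
    simp only [Set.mem_ofPred_eq, Set.mem_iUnion, Set.mem_inter_iff, Set.mem_preimage,
      Set.mem_singleton_iff, exists_prop]
    constructor
    · rintro ⟨h1, h2⟩
      exact ⟨_, h1, rfl, h2⟩
    · rintro ⟨q, hq, rfl, h2⟩
      exact ⟨hq, h2⟩
  rw [hdec, measure_biUnion (Set.to_countable A)]
  · rw [← Set.preimage_ofPred_eq (p := fun q ↦ q ∈ A) (f := fun ω ↦ (N s ω, N t ω)), Set.ofPred_mem_eq,
      ← tsum_measure_preimage_singleton (Set.to_countable A)
        (fun q _ ↦ hpair (measurableSet_singleton q)), ← ENNReal.tsum_mul_right]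
    refine tsum_congr fun q ↦ ?_
    rw [← hc q.1.1 q.1.2 q.2]
    have := hind.measure_inter_preimage_eq_mul {n : ℝ≥0 → ℕ | (n s, n t) = q.1}
      {x : ℕ → Bool | x q.1.1 = a ∧ x q.1.2 = b}
      (measurableSet_eq_fun ((measurable_pi_apply s).prodMk (measurable_pi_apply t))
        measurable_const)
      ((measurableSet_eq_fun (measurable_pi_apply _) measurable_const).inter
        (measurableSet_eq_fun (measurable_pi_apply _) measurable_const))
    exact this
  · intro q _ q' _ hne
    refine Set.disjoint_left.2 fun ω h1 h2 ↦ hne ?_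
    exact h1.1.symm.trans h2.1
  · exact fun q _ ↦ (hpair (measurableSet_singleton q)).inter (hset _ _)

variable [IsProbabilityMeasure P]

lemma IsRateOnePoissonProcess.measureReal_ne (hN : IsRateOnePoissonProcess P N) {s t : ℝ≥0}
    (hst : s ≤ t) : P.real {ω | N s ω ≠ N t ω} = 1 - Real.exp (-(t - s : ℝ)) := by
  have h0 : P.real {ω | N t ω - N s ω = 0} = Real.exp (-(t - s : ℝ)) := by
    rw [(hN.law_increment s t hst).measureReal_eq (p := fun k ↦ k = 0) (by measurability)]
    simp [poissonMeasure_real_singleton, NNReal.coe_sub hst]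
  have h1 : P.real {ω | N s ω = N t ω} = P.real {ω | N t ω - N s ω = 0} := by
    refine measureReal_congr ?_
    filter_upwards [hN.paths] with ω hω
    have := hω.2.1 hst
    simp only [eq_iff_iff]
    change N s ω = N t ω ↔ N t ω - N s ω = 0
    have h2 : N s ω ≤ N t ω := this
    omega
  have h2 : MeasurableSet {ω | N s ω = N t ω} :=
    measurableSet_eq_fun (hN.measurable s) (hN.measurable t)
  rw [← h0, ← h1, ← probReal_compl_eq_one_sub h2]
  rfl

lemma measureReal_bit_eq (hm : ∀ k, Measurable (ξ k))
    (hp : ∀ k, P {ω | ξ k ω = true} = ENNReal.ofReal p) (h0 : 0 ≤ p) (k : ℕ) (a : Bool) :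
    P.real {ω | ξ k ω = a} = if a then p else 1 - p := by
  have h1 : P.real {ω | ξ k ω = true} = p := by
    rw [measureReal_def, hp, ENNReal.toReal_ofReal h0]
  cases a with
  | true => simpa using h1
  | false =>
    have : {ω | ξ k ω = false} = {ω | ξ k ω = true}ᶜ := by ext ω; simp
    rw [this, probReal_compl_eq_one_sub (measurableSet_eq_fun (hm k) measurable_const), h1]
    simp

lemma measureReal_sampled_eq_true (hN : ∀ t, Measurable (N t)) (hm : ∀ k, Measurable (ξ k))
    (hp : ∀ k, P {ω | ξ k ω = true} = ENNReal.ofReal p) (h0 : 0 ≤ p)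
    (hind : IndepFun (fun ω t ↦ N t ω) (fun ω k ↦ ξ k ω) P) (t : ℝ≥0) :
    P.real {ω | ξ (N t ω) ω = true} = p := by
  have := measure_sampled_eq (P := P) hN hm hind (c := ENNReal.ofReal p)
    (A := {q | q.1 = q.2}) (a := true) (b := true) t t (fun k l hkl ↦ by
      obtain rfl : k = l := hkl
      simpa using hp k)
  simp only [Set.mem_ofPred_eq, true_and, and_self, Set.ofPred_true, measure_univ, one_mul] at this
  rw [measureReal_def, this, ENNReal.toReal_ofReal h0]

/-- Different values force the clock to have rung in between. The two indices are then distinct and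
the two draws independent. -/
lemma measureReal_sampled_ne (hN : IsRateOnePoissonProcess P N) (hm : ∀ k, Measurable (ξ k))
    (hp : ∀ k, P {ω | ξ k ω = true} = ENNReal.ofReal p) (h0 : 0 ≤ p) (hξ : iIndepFun ξ P)
    (hind : IndepFun (fun ω t ↦ N t ω) (fun ω k ↦ ξ k ω) P) {s t : ℝ≥0} (hst : s ≤ t)
    (a : Bool) :
    P.real {ω | ξ (N s ω) ω = a ∧ ξ (N t ω) ω = !a} =
      p * (1 - p) * (1 - Real.exp (-(t - s : ℝ))) := by
  have hc : ∀ k l, (k, l) ∈ {q : ℕ × ℕ | q.1 ≠ q.2} →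
      P {ω | ξ k ω = a ∧ ξ l ω = !a} = P {ω | ξ 0 ω = a} * P {ω | ξ 1 ω = !a} := by
    intro k l hkl
    have h1 := (hξ.indepFun hkl).measure_inter_preimage_eq_mul {a} {!a}
      (measurableSet_singleton _) (measurableSet_singleton _)
    have h2 : ∀ k l b, P {ω | ξ k ω = b} = P {ω | ξ l ω = b} := fun k l b ↦ by
      rw [← measureReal_eq_measureReal_iff, measureReal_bit_eq hm hp h0,
        measureReal_bit_eq hm hp h0]
    rw [h2 0 k, h2 1 l]
    exact h1
  have h := measure_sampled_eq (P := P) hN.measurable hm hind s t hc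
  have h3 : {ω | (N s ω, N t ω) ∈ {q : ℕ × ℕ | q.1 ≠ q.2} ∧ ξ (N s ω) ω = a ∧
      ξ (N t ω) ω = !a} = {ω | ξ (N s ω) ω = a ∧ ξ (N t ω) ω = !a} := by
    ext ω
    simp only [Set.mem_ofPred_eq, and_iff_right_iff_imp]
    rintro ⟨h1, h2⟩ h3
    rw [← h3, h1] at h2
    cases a <;> simp at h2
  rw [h3] at h
  have h4 := congrArg ENNReal.toReal h
  rw [ENNReal.toReal_mul, ENNReal.toReal_mul] at h4
  simp only [← measureReal_def] at h4
  rw [h4, measureReal_bit_eq hm hp h0, measureReal_bit_eq hm hp h0]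
  have h5 := hN.measureReal_ne hst
  simp only [Set.mem_ofPred_eq]
  rw [h5]
  cases a <;> simp <;> ring

end Coordinate

section Walk

variable {n : ℕ} {p : ℝ} {Ω : Type*} [MeasurableSpace Ω] {P : Measure Ω}
  {X : ℝ≥0 → Ω → Fin n → Bool}

lemma measurable_eval_sampled (t : ℝ≥0) :
    Measurable fun q : (ℝ≥0 → ℕ) × (ℕ → Bool) ↦ q.2 (q.1 t) := by
  have : Measurable fun q : ℕ × (ℕ → Bool) ↦ q.2 q.1 :=
    measurable_from_prod_countable_right fun k ↦ measurable_pi_apply k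
  have h2 : Measurable fun q : (ℝ≥0 → ℕ) × (ℕ → Bool) ↦ (q.1 t, q.2) :=
    ((measurable_pi_apply t).comp measurable_fst).prodMk measurable_snd
  exact this.comp h2

lemma IsBiasedWalk.isResampledPair [IsProbabilityMeasure P] (hX : IsBiasedWalk p P X)
    (h0 : 0 ≤ p) {s t : ℝ≥0} (hst : s ≤ t) :
    IsResampledPair p (1 - Real.exp (-(t - s : ℝ))) P (X s) (X t) := by
  obtain ⟨N, ξ, hN, hm, hp, hξ, hind, hall, hX⟩ := hX
  have hmeas : ∀ t i, Measurable fun ω ↦ X t ω i := fun t i ↦ by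
    simp only [hX]
    exact (measurable_eval_sampled t).comp ((measurable_pi_lambda _ fun t ↦ (hN i).measurable t).prodMk
      (measurable_pi_lambda _ fun k ↦ hm i k))
  refine ⟨hmeas s, hmeas t, ?_, fun i ↦ ?_, fun i ↦ ?_, fun i ↦ ?_, fun i ↦ ?_⟩
  · have := hall.comp (fun _ q ↦ (q.2 (q.1 s), q.2 (q.1 t)))
      fun _ ↦ (measurable_eval_sampled s).prodMk (measurable_eval_sampled t)
    simp only [hX]
    exact this
  · simp only [hX]
    exact measureReal_sampled_eq_true (hN i).measurable (hm i) (hp i) h0 (hind i) s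
  · simp only [hX]
    exact measureReal_sampled_eq_true (hN i).measurable (hm i) (hp i) h0 (hind i) t
  · simp only [hX]
    exact measureReal_sampled_ne (hN i) (hm i) (hp i) h0 (hξ i) (hind i) hst false
  · simp only [hX]
    exact measureReal_sampled_ne (hN i) (hm i) (hp i) h0 (hξ i) (hind i) hst true

lemma IsBiasedWalk.ae_rightContinuous (hX : IsBiasedWalk p P X) (f : (Fin n → Bool) → Bool) :
    ∀ᵐ ω ∂P, ∀ t, ContinuousWithinAt (fun t ↦ f (X t ω)) (Set.Ici t) t := by
  obtain ⟨N, ξ, hN, -, -, -, -, -, hX⟩ := hX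
  have : ∀ᵐ ω ∂P, ∀ i, ∀ t, ContinuousWithinAt (fun t ↦ N i t ω) (Set.Ici t) t :=
    ae_all_iff.2 fun i ↦ (hN i).paths.mono fun ω h ↦ h.2.2
  filter_upwards [this] with ω hω t
  have h1 : ContinuousWithinAt (fun t ↦ X t ω) (Set.Ici t) t := by
    refine continuousWithinAt_pi.2 fun i ↦ ?_
    simp only [hX]
    exact (continuous_of_discreteTopology (f := fun k ↦ ξ i k ω)).continuousAt.comp_continuousWithinAt
      (hω i t)
  exact (continuous_of_discreteTopology (f := f)).continuousAt.comp_continuousWithinAt h1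

end Walk

/-! ### Product estimates for resampled pairs -/

section ResampledPair

variable {ι Ω : Type*} [MeasurableSpace Ω] {p ε : ℝ} {P : Measure Ω} {Y Z : Ω → ι → Bool}

lemma IsResampledPair.measureReal_forall_mem (h : IsResampledPair p ε P Y Z) (S : Finset ι)
    (A : ι → Set (Bool × Bool)) :
    P.real {ω | ∀ i ∈ S, (Y ω i, Z ω i) ∈ A i} =
      ∏ i ∈ S, P.real {ω | (Y ω i, Z ω i) ∈ A i} := by
  have := h.indep.measure_inter_preimage_eq_mul S (sets := A)
    fun i _ ↦ (Set.to_countable (A i)).measurableSet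
  have h2 : {ω | ∀ i ∈ S, (Y ω i, Z ω i) ∈ A i} =
      ⋂ i ∈ S, (fun ω ↦ (Y ω i, Z ω i)) ⁻¹' A i := by
    ext ω; simp
  rw [measureReal_def, h2, this, ENNReal.toReal_prod]
  rfl

lemma IsResampledPair.measureReal_forall_true (h : IsResampledPair p ε P Y Z) (S : Finset ι) :
    P.real {ω | ∀ i ∈ S, Y ω i = true} = p ^ S.card := by
  have := h.measureReal_forall_mem S fun _ ↦ {q | q.1 = true}
  simpa [h.prob_left] using this

lemma IsResampledPair.measureReal_forall_eq (h : IsResampledPair p ε P Y Z) [Fintype ι]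
    (x : ι → Bool) : P.real {ω | Y ω = x} = ∏ i, P.real {ω | Y ω i = x i} := by
  have := h.measureReal_forall_mem Finset.univ fun i ↦ {q | q.1 = x i}
  simpa [funext_iff] using this

/-- By independence the site `i` contributes `p * (1 - p) * ε` and every other site of `S`
contributes `p`. The factor `ε` is what makes the expected number of changes over a unit of time
bounded uniformly in the mesh. -/
lemma IsResampledPair.measureReal_forall_true_and_false (h : IsResampledPair p ε P Y Z)
    (hp : p ∈ Set.Icc 0 1) (hε : 0 ≤ ε) {S : Finset ι} {i : ι} (hi : i ∈ S) :
    P.real {ω | (∀ j ∈ S, Z ω j = true) ∧ Y ω i = false} ≤ p ^ S.card * ε := by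
  classical
  have h1 := h.measureReal_forall_mem S
    fun j ↦ if j = i then {q | q.1 = false ∧ q.2 = true} else {q | q.2 = true}
  have h2 : {ω | (∀ j ∈ S, Z ω j = true) ∧ Y ω i = false} = {ω | ∀ j ∈ S, (Y ω j, Z ω j) ∈
      if j = i then {q : Bool × Bool | q.1 = false ∧ q.2 = true} else {q | q.2 = true}} := by
    ext ω
    simp only [Set.mem_ofPred_eq]
    constructor
    · rintro ⟨h3, h4⟩ j hj
      split_ifs with hji
      · subst hji
        exact ⟨h4, h3 j hj⟩
      · exact h3 j hj
    · intro h3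
      refine ⟨fun j hj ↦ ?_, ?_⟩
      · have := h3 j hj
        split_ifs at this with hji
        · exact this.2
        · exact this
      · have := h3 i hi
        rw [if_pos rfl] at this
        exact this.1
  rw [h2, h1, ← Finset.mul_prod_erase S _ hi]
  have h3 : ∏ j ∈ S.erase i, P.real {ω | (Y ω j, Z ω j) ∈
      if j = i then {q : Bool × Bool | q.1 = false ∧ q.2 = true} else {q | q.2 = true}} =
      p ^ (S.card - 1) := by
    rw [← Finset.card_erase_of_mem hi, ← Finset.prod_const]
    refine Finset.prod_congr rfl fun j hj ↦ ?_
    rw [if_neg (Finset.ne_of_mem_erase hj)]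
    exact h.prob_right j
  rw [h3, if_pos rfl]
  have h4 : P.real {ω | (Y ω i, Z ω i) ∈ {q : Bool × Bool | q.1 = false ∧ q.2 = true}} =
      p * (1 - p) * ε := h.prob_up i
  rw [h4]
  have h5 : p ^ S.card = p * p ^ (S.card - 1) := by
    rw [← pow_succ', Nat.sub_add_cancel (Finset.card_pos.2 ⟨i, hi⟩)]
  rw [h5]
  have h6 : 0 ≤ p * p ^ (S.card - 1) * ε := by have := hp.1; positivity
  nlinarith [hp.1]

variable [IsProbabilityMeasure P]

lemma IsResampledPair.measureReal_left_eq (h : IsResampledPair p ε P Y Z) (i : ι) (a : Bool) :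
    P.real {ω | Y ω i = a} = if a then p else 1 - p := by
  cases a with
  | true => simpa using h.prob_left i
  | false =>
    have : {ω | Y ω i = false} = {ω | Y ω i = true}ᶜ := by ext ω; simp
    rw [this, probReal_compl_eq_one_sub
      (measurableSet_eq_fun (h.measurable_left i) measurable_const), h.prob_left]
    simp

lemma IsResampledPair.le_measureReal_eq_and_eq (h : IsResampledPair p ε P Y Z)
    (hp : p ∈ Set.Icc 0 1) (hε : 0 ≤ ε) (i : ι) (a : Bool) :
    (1 - ε) * P.real {ω | Y ω i = a} ≤ P.real {ω | Y ω i = a ∧ Z ω i = a} := by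
  have h1 : P.real {ω | Y ω i = a} =
      P.real {ω | Y ω i = a ∧ Z ω i = a} + P.real {ω | Y ω i = a ∧ Z ω i = !a} := by
    have := measureReal_inter_add_sdiff (μ := P) (s := {ω | Y ω i = a})
      (measurableSet_eq_fun (h.measurable_right i) (measurable_const (a := a)))
    rw [← this]
    congr 2
    ext ω
    simp [Bool.eq_not]
  have h2 : P.real {ω | Y ω i = a ∧ Z ω i = !a} = p * (1 - p) * ε := by
    cases a with
    | true => exact h.prob_down i
    | false => exact h.prob_up i
  have h3 : p * (1 - p) * ε ≤ P.real {ω | Y ω i = a} * ε := by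
    refine mul_le_mul_of_nonneg_right ?_ hε
    rw [h.measureReal_left_eq]
    have := hp.1
    have := hp.2
    cases a <;> simp <;> nlinarith
  linarith

/-- If `f` changes whenever a coordinate of a point of `A` is switched on, then `f` is likely to
have different values on a resampled pair that starts in `A`. -/
lemma IsResampledPair.le_measureReal_ne (h : IsResampledPair p ε P Y Z) [Fintype ι]
    (hp : p ∈ Set.Icc 0 1) (hε : ε ∈ Set.Icc 0 1) {β : Type*} {f : (ι → Bool) → β}
    {A : Set (ι → Bool)}
    (hf : ∀ x ∈ A, ∀ i, x i = false → ∀ y, y i = true → (∀ j, j ≠ i → y j = x j) → f x ≠ f y) :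
    Fintype.card ι * (p * ε * (1 - ε) ^ Fintype.card ι * (P.real {ω | Y ω ∈ A} - p)) ≤
      P.real {ω | f (Y ω) ≠ f (Z ω)} := by
  classical
  have hY : Measurable Y := measurable_pi_iff.2 h.measurable_left
  have hZ : Measurable Z := measurable_pi_iff.2 h.measurable_right
  have hε' : 0 ≤ 1 - ε := by linarith [hε.2]
  -- The pair starts in `A` and differs exactly in that site `i` is switched on. These events are
  -- disjoint for different `i`, so their probabilities add up.
  let E : ι → Set Ω := fun i ↦
    {ω | (Y ω ∈ A ∧ Y ω i = false) ∧ Z ω i = true ∧ ∀ j, j ≠ i → Z ω j = Y ω j}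
  have hE : ∀ i, MeasurableSet (E i) := fun i ↦ (hY.prodMk hZ) (MeasurableSet.of_discrete
    (s := {q : (ι → Bool) × (ι → Bool) |
      (q.1 ∈ A ∧ q.1 i = false) ∧ q.2 i = true ∧ ∀ j, j ≠ i → q.2 j = q.1 j}))
  have hsub : (⋃ i ∈ (Finset.univ : Finset ι), E i) ⊆ {ω | f (Y ω) ≠ f (Z ω)} := by
    simp only [Finset.mem_univ, Set.iUnion_true]
    refine Set.iUnion_subset fun i ω hω ↦ ?_
    exact hf _ hω.1.1 i hω.1.2 _ hω.2.1 hω.2.2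
  have hdisj : ((Finset.univ : Finset ι) : Set ι).PairwiseDisjoint E := by
    intro i _ j _ hij
    refine Set.disjoint_left.2 fun ω h1 h2 ↦ ?_
    have := h2.2.2 i hij
    rw [h1.2.1, h1.1.2] at this
    simp at this
  refine le_trans ?_ (measureReal_mono hsub)
  rw [measureReal_biUnion_finset hdisj fun i _ ↦ hE i]
  rw [← nsmul_eq_mul, ← Finset.card_univ]
  refine Finset.card_nsmul_le_sum _ _ _ fun i _ ↦ ?_
  -- Given the starting point `x`, site `i` is switched on with probability `p * ε`, and every other
  -- site keeps its value with probability at least `1 - ε`.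
  have hpt : ∀ x : ι → Bool, x i = false →
      p * ε * (1 - ε) ^ Fintype.card ι * P.real {ω | Y ω = x} ≤
        P.real {ω | Y ω = x ∧ Z ω = Function.update x i true} := by
    intro x hx
    have h1 := h.measureReal_forall_mem Finset.univ
      fun j ↦ {q | q.1 = x j ∧ q.2 = Function.update x i true j}
    have h2 : {ω | Y ω = x ∧ Z ω = Function.update x i true} =
        {ω | ∀ j ∈ Finset.univ, (Y ω j, Z ω j) ∈
          {q : Bool × Bool | q.1 = x j ∧ q.2 = Function.update x i true j}} := by
      ext ω
      simp [funext_iff, forall_and]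
    rw [h2, h1, h.measureReal_forall_eq x, ← Finset.mul_prod_erase _ _ (Finset.mem_univ i),
      ← Finset.mul_prod_erase _ (fun j ↦ P.real {ω | (Y ω j, Z ω j) ∈
          {q : Bool × Bool | q.1 = x j ∧ q.2 = Function.update x i true j}}) (Finset.mem_univ i)]
    have h3 : (1 - ε) ^ (Fintype.card ι - 1) *
        ∏ j ∈ Finset.univ.erase i, P.real {ω | Y ω j = x j} ≤
        ∏ j ∈ Finset.univ.erase i, P.real {ω | (Y ω j, Z ω j) ∈
          {q : Bool × Bool | q.1 = x j ∧ q.2 = Function.update x i true j}} := by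
      rw [← Finset.card_univ, ← Finset.card_erase_of_mem (Finset.mem_univ i),
        ← Finset.prod_const, ← Finset.prod_mul_distrib]
      refine Finset.prod_le_prod (fun j _ ↦ by positivity) fun j hj ↦ ?_
      rw [Function.update_of_ne (Finset.ne_of_mem_erase hj)]
      exact h.le_measureReal_eq_and_eq hp hε.1 j (x j)
    have h4 : P.real {ω | (Y ω i, Z ω i) ∈
        {q : Bool × Bool | q.1 = x i ∧ q.2 = Function.update x i true i}} =
        p * ε * P.real {ω | Y ω i = x i} := by
      rw [h.measureReal_left_eq, hx, Function.update_self]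
      have := h.prob_up i
      simp only [Set.mem_ofPred_eq, this]
      simp
      ring
    rw [h4]
    have h5 : (1 - ε) ^ Fintype.card ι ≤ (1 - ε) ^ (Fintype.card ι - 1) :=
      pow_le_pow_of_le_one hε' (by linarith [hε.1]) (Nat.sub_le _ _)
    have h6 : 0 ≤ p * ε * P.real {ω | Y ω i = x i} := by
      have := hp.1; have := hε.1; positivity
    calc p * ε * (1 - ε) ^ Fintype.card ι * (P.real {ω | Y ω i = x i} *
            ∏ j ∈ Finset.univ.erase i, P.real {ω | Y ω j = x j})
        = (p * ε * P.real {ω | Y ω i = x i}) * ((1 - ε) ^ Fintype.card ι *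
            ∏ j ∈ Finset.univ.erase i, P.real {ω | Y ω j = x j}) := by ring
      _ ≤ (p * ε * P.real {ω | Y ω i = x i}) * ((1 - ε) ^ (Fintype.card ι - 1) *
            ∏ j ∈ Finset.univ.erase i, P.real {ω | Y ω j = x j}) := by
          gcongr
      _ ≤ _ := by gcongr
  have hsum1 : P.real {ω | Y ω ∈ A ∧ Y ω i = false} =
      ∑ x ∈ Finset.univ.filter (fun x : ι → Bool ↦ x ∈ A ∧ x i = false),
        P.real {ω | Y ω = x} := by
    have := sum_measureReal_preimage_singleton (μ := P)
      (Finset.univ.filter (fun x : ι → Bool ↦ x ∈ A ∧ x i = false)) (f := Y)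
      fun y _ ↦ hY (measurableSet_singleton y)
    rw [← Set.preimage_ofPred_eq (p := fun x : ι → Bool ↦ x ∈ A ∧ x i = false)]
    simpa using! this.symm
  have hsum2 : ∑ x ∈ Finset.univ.filter (fun x : ι → Bool ↦ x ∈ A ∧ x i = false),
        P.real {ω | Y ω = x ∧ Z ω = Function.update x i true} ≤ P.real (E i) := by
    rw [← measureReal_biUnion_finset]
    · refine measureReal_mono ?_
      refine Set.iUnion₂_subset fun x hx ω hω ↦ ?_
      obtain ⟨h1, h2⟩ : Y ω = x ∧ Z ω = Function.update x i true := hω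
      have hx' := (Finset.mem_filter.1 hx).2
      refine ⟨by rw [h1]; exact hx', by rw [h2, Function.update_self], fun j hj ↦ ?_⟩
      rw [h1, h2, Function.update_of_ne hj]
    · intro x _ x' _ hne
      refine Set.disjoint_left.2 fun ω h1 h2 ↦ hne ?_
      exact h1.1.symm.trans h2.1
    · exact fun x _ ↦ (hY (measurableSet_singleton x)).inter
        (hZ (measurableSet_singleton (Function.update x i true)))
  have hA : P.real {ω | Y ω ∈ A} - p ≤ P.real {ω | Y ω ∈ A ∧ Y ω i = false} := by
    have h1 : {ω | Y ω ∈ A} ⊆ {ω | Y ω ∈ A ∧ Y ω i = false} ∪ {ω | Y ω i = true} := by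
      intro ω hω
      by_cases hi : Y ω i = true
      · exact Or.inr hi
      · exact Or.inl ⟨hω, by simpa using hi⟩
    have h2 := (measureReal_mono (μ := P) h1).trans (measureReal_union_le _ _)
    rw [h.prob_left] at h2
    linarith
  refine le_trans ?_ hsum2
  refine le_trans ?_ (Finset.sum_le_sum fun x hx ↦ hpt x (Finset.mem_filter.1 hx).2.2)
  rw [← Finset.mul_sum, ← hsum1]
  have : 0 ≤ p * ε * (1 - ε) ^ Fintype.card ι := by
    have := hp.1; have := hε.1; positivity
  exact mul_le_mul_of_nonneg_left hA this

end ResampledPair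

/-! ### Probability and stability of dense blocks -/

section Blocks

variable {B s : ℕ}

/-- The coordinates `0, …, B * s - 1` are arranged in `B` blocks of size `s`; these are the
positions in block `b` at which `x` is true. -/
def blockOnes (x : Fin (B * s) → Bool) (b : Fin B) : Finset (Fin s) :=
  Finset.univ.filter fun j ↦ x (finProdFinEquiv (b, j)) = true

/-- The inclusion of block `b`. -/
def blockEmbedding (b : Fin B) : Fin s ↪ Fin (B * s) :=
  ⟨fun j ↦ finProdFinEquiv (b, j), fun j j' hj ↦ by simpa using hj⟩

/-- Some block contains at least `k` ones. -/
def HasDenseBlock (k : ℕ) (x : Fin (B * s) → Bool) : Prop :=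
  ∃ b, k ≤ (blockOnes x b).card

lemma HasDenseBlock.mono {k l : ℕ} (hkl : k ≤ l) {x : Fin (B * s) → Bool}
    (h : HasDenseBlock l x) : HasDenseBlock k x :=
  h.imp fun _ hb ↦ hkl.trans hb

lemma hasDenseBlock_iff_exists_subset {k : ℕ} {x : Fin (B * s) → Bool} :
    HasDenseBlock k x ↔ ∃ b, ∃ T : Finset (Fin s), T.card = k ∧
      ∀ j ∈ T, x (finProdFinEquiv (b, j)) = true := by
  refine exists_congr fun b ↦ ⟨fun h ↦ ?_, fun ⟨T, hT, h⟩ ↦ ?_⟩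
  · obtain ⟨T, hT, hc⟩ := Finset.exists_subset_card_eq h
    exact ⟨T, hc, fun j hj ↦ (Finset.mem_filter.1 (hT hj)).2⟩
  · rw [← hT]
    exact Finset.card_le_card fun j hj ↦ Finset.mem_filter.2 ⟨Finset.mem_univ j, h j hj⟩

variable {Ω : Type*} [MeasurableSpace Ω] {p ε : ℝ} {P : Measure Ω} {Y Z : Ω → Fin (B * s) → Bool}

lemma sum_blocks_le (hp : 0 ≤ p) (k : ℕ) (c : ℝ) (hc : 0 ≤ c) :
    ∑ _b : Fin B, ∑ _T ∈ Finset.powersetCard k (Finset.univ : Finset (Fin s)), p ^ k * c ≤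
      B * (s * p) ^ k * c := by
  simp only [Finset.sum_const, Finset.card_univ, Fintype.card_fin, Finset.card_powersetCard,
    nsmul_eq_mul]
  have : (s.choose k : ℝ) ≤ (s : ℝ) ^ k := by exact_mod_cast Nat.choose_le_pow s k
  rw [mul_pow]
  calc (B : ℝ) * (s.choose k * (p ^ k * c)) ≤ B * ((s : ℝ) ^ k * (p ^ k * c)) := by gcongr
    _ = _ := by ring

variable [IsProbabilityMeasure P]

lemma IsResampledPair.measureReal_hasDenseBlock_le (h : IsResampledPair p ε P Y Z) (hp : 0 ≤ p)
    (k : ℕ) : P.real {ω | HasDenseBlock k (Y ω)} ≤ B * (s * p) ^ k := by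
  have hsub : {ω | HasDenseBlock k (Y ω)} ⊆ ⋃ b ∈ (Finset.univ : Finset (Fin B)),
      ⋃ T ∈ Finset.powersetCard k (Finset.univ : Finset (Fin s)),
        {ω | ∀ i ∈ T.map (blockEmbedding b),
          Y ω i = true} := by
    intro ω hω
    obtain ⟨b, T, hT, hall⟩ := hasDenseBlock_iff_exists_subset.1 hω
    simp only [Set.mem_iUnion]
    exact ⟨b, Finset.mem_univ b, T, Finset.mem_powersetCard.2 ⟨Finset.subset_univ T, hT⟩,
      Finset.forall_mem_map.2 hall⟩
  refine (measureReal_mono hsub (measure_ne_top _ _)).trans ((measureReal_biUnion_finset_le _ _).trans ?_)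
  have h1 := sum_blocks_le (B := B) (s := s) hp k 1 zero_le_one
  rw [mul_one (_ * _)] at h1
  refine le_trans (Finset.sum_le_sum fun b _ ↦ ?_) h1
  refine (measureReal_biUnion_finset_le _ _).trans (Finset.sum_le_sum fun T hT ↦ ?_)
  rw [h.measureReal_forall_true, Finset.card_map, (Finset.mem_powersetCard.1 hT).2, mul_one]

/-- A set of `k` ones in a block of `Z` cannot be all ones in `Y`, so one of its `k` sites was
switched on. The union bound runs over the block, the `k`-subset and that site. -/
lemma IsResampledPair.measureReal_hasDenseBlock_and_not_le (h : IsResampledPair p ε P Y Z)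
    (hp : p ∈ Set.Icc 0 1) (hε : 0 ≤ ε) (k : ℕ) :
    P.real {ω | HasDenseBlock k (Z ω) ∧ ¬ HasDenseBlock k (Y ω)} ≤
      k * (B * (s * p) ^ k) * ε := by
  have hsub : {ω | HasDenseBlock k (Z ω) ∧ ¬ HasDenseBlock k (Y ω)} ⊆
      ⋃ b ∈ (Finset.univ : Finset (Fin B)),
      ⋃ T ∈ Finset.powersetCard k (Finset.univ : Finset (Fin s)), ⋃ j ∈ T,
        {ω | (∀ i ∈ T.map (blockEmbedding b),
          Z ω i = true) ∧ Y ω (blockEmbedding b j) = false} := by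
    rintro ω ⟨hZ, hY⟩
    obtain ⟨b, T, hT, hall⟩ := hasDenseBlock_iff_exists_subset.1 hZ
    have : ∃ j ∈ T, Y ω (blockEmbedding b j) = false := by
      by_contra! hcon
      exact hY (hasDenseBlock_iff_exists_subset.2 ⟨b, T, hT, fun j hj ↦ by simpa using! hcon j hj⟩)
    obtain ⟨j, hj, hjf⟩ := this
    simp only [Set.mem_iUnion]
    exact ⟨b, Finset.mem_univ b, T, Finset.mem_powersetCard.2 ⟨Finset.subset_univ T, hT⟩, j, hj,
      Finset.forall_mem_map.2 hall, hjf⟩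
  refine (measureReal_mono hsub (measure_ne_top _ _)).trans ((measureReal_biUnion_finset_le _ _).trans ?_)
  have h1 := sum_blocks_le (B := B) (s := s) hp.1 k (k * ε) (by positivity)
  have h2 : k * (B * (s * p) ^ k) * ε = B * (s * p) ^ k * (k * ε) := by ring
  rw [h2]
  refine le_trans (Finset.sum_le_sum fun b _ ↦ ?_) h1
  refine (measureReal_biUnion_finset_le _ _).trans (Finset.sum_le_sum fun T hT ↦ ?_)
  refine (measureReal_biUnion_finset_le _ _).trans ?_
  have hTk := (Finset.mem_powersetCard.1 hT).2
  refine (Finset.sum_le_card_nsmul T _ (p ^ k * ε) fun j hj ↦ ?_).trans (le_of_eq ?_)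
  · refine (h.measureReal_forall_true_and_false hp hε (Finset.mem_map_of_mem _ hj)).trans ?_
    rw [Finset.card_map, hTk]
  · rw [hTk, nsmul_eq_mul]
    ring

lemma IsResampledPair.measureReal_hasDenseBlock_ne_le (h : IsResampledPair p ε P Y Z)
    (hp : p ∈ Set.Icc 0 1) (hε : 0 ≤ ε) (k : ℕ) :
    P.real {ω | ¬ (HasDenseBlock k (Y ω) ↔ HasDenseBlock k (Z ω))} ≤
      2 * (k * (B * (s * p) ^ k) * ε) := by
  have hsub : {ω | ¬ (HasDenseBlock k (Y ω) ↔ HasDenseBlock k (Z ω))} ⊆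
      {ω | HasDenseBlock k (Z ω) ∧ ¬ HasDenseBlock k (Y ω)} ∪
        {ω | HasDenseBlock k (Y ω) ∧ ¬ HasDenseBlock k (Z ω)} := by
    intro ω hω
    simp only [Set.mem_ofPred_eq, Set.mem_union] at hω ⊢
    tauto
  refine (measureReal_mono hsub).trans ((measureReal_union_le _ _).trans ?_)
  have h1 := h.measureReal_hasDenseBlock_and_not_le hp hε k
  have h2 := h.symm.measureReal_hasDenseBlock_and_not_le hp hε k
  linarith

lemma IsResampledPair.measureReal_blockOnes_eq (h : IsResampledPair p ε P Y Z)
    (T : Fin B → Finset (Fin s)) :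
    P.real {ω | blockOnes (Y ω) = T} = ∏ b, p ^ (T b).card * (1 - p) ^ (s - (T b).card) := by
  have h1 : {ω | blockOnes (Y ω) = T} =
      {ω | Y ω = fun i ↦ decide ((finProdFinEquiv.symm i).2 ∈ T (finProdFinEquiv.symm i).1)} := by
    ext ω
    simp only [Set.mem_ofPred_eq, funext_iff, Finset.ext_iff, blockOnes, Finset.mem_filter,
      Finset.mem_univ, true_and]
    rw [← finProdFinEquiv.forall_congr_right, Prod.forall]
    refine forall_congr' fun b ↦ forall_congr' fun j ↦ ?_
    by_cases hj : j ∈ T b <;> simp [hj]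
  rw [h1, h.measureReal_forall_eq, ← finProdFinEquiv.prod_comp, Fintype.prod_prod_type]
  refine Finset.prod_congr rfl fun b _ ↦ ?_
  simp only [h.measureReal_left_eq, Equiv.symm_apply_apply, decide_eq_true_eq]
  rw [Finset.prod_ite, Finset.prod_const, Finset.prod_const, Finset.filter_not,
    Finset.card_sdiff_of_subset (Finset.filter_subset _ _)]
  simp

/-- The blocks are independent and identically distributed. The proof sums the product law of
`blockOnes` over a product of families of subsets. -/
lemma IsResampledPair.measureReal_not_hasDenseBlock (h : IsResampledPair p ε P Y Z) (k : ℕ) :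
    P.real {ω | ¬ HasDenseBlock k (Y ω)} =
      (1 - ∑ T : Finset (Fin s) with k ≤ T.card, p ^ T.card * (1 - p) ^ (s - T.card)) ^ B := by
  have hY : Measurable Y := measurable_pi_iff.2 h.measurable_left
  have h1 : {ω | ¬ HasDenseBlock k (Y ω)} = (fun ω ↦ blockOnes (Y ω)) ⁻¹'
      (Fintype.piFinset fun _ : Fin B ↦ Finset.univ.filter fun T : Finset (Fin s) ↦ T.card < k) := by
    ext ω
    simp [HasDenseBlock]
  rw [h1, ← sum_measureReal_preimage_singleton]
  · have h2 : ∀ T : Fin B → Finset (Fin s), P.real ((fun ω ↦ blockOnes (Y ω)) ⁻¹' {T}) =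
        ∏ b, p ^ (T b).card * (1 - p) ^ (s - (T b).card) := h.measureReal_blockOnes_eq
    simp only [h2]
    rw [← Finset.prod_univ_sum (fun _ : Fin B ↦ Finset.univ.filter
      fun T : Finset (Fin s) ↦ T.card < k) fun _ T ↦ p ^ T.card * (1 - p) ^ (s - T.card)]
    rw [Finset.prod_const, Finset.card_univ, Fintype.card_fin]
    congr 1
    rw [eq_sub_iff_add_eq]
    have h3 := Fin.sum_pow_mul_eq_add_pow (n := s) p (1 - p)
    rw [add_sub_cancel, one_pow] at h3
    refine Eq.trans ?_ h3
    rw [← Finset.sum_filter_add_sum_filter_not Finset.univ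
      (fun T : Finset (Fin s) ↦ T.card < k)]
    simp only [not_lt]
  · intro T _
    exact hY (MeasurableSet.of_discrete (s := {x | blockOnes x = T}))

/-- Only the sets of size exactly `k` are kept. Then `s.choose k` is at least `(s / 2) ^ k / k!` as
`2 * k ≤ s`, and `(1 - p) ^ (s - k)` is at least `1 - s * p ≥ 1 / 2` by Bernoulli. -/
lemma le_sum_filter_card_ge {k : ℕ} (hp : p ∈ Set.Icc 0 1) (hks : 2 * k ≤ s)
    (hsp : s * p ≤ 1 / 2) :
    (s * p) ^ k / (2 ^ (k + 1) * k.factorial) ≤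
      ∑ T : Finset (Fin s) with k ≤ T.card, p ^ T.card * (1 - p) ^ (s - T.card) := by
  have h0 := hp.1
  have h1 : 0 ≤ 1 - p := by linarith [hp.2]
  have hle : ∑ T ∈ Finset.powersetCard k (Finset.univ : Finset (Fin s)),
      p ^ T.card * (1 - p) ^ (s - T.card) ≤
      ∑ T : Finset (Fin s) with k ≤ T.card, p ^ T.card * (1 - p) ^ (s - T.card) := by
    refine Finset.sum_le_sum_of_subset_of_nonneg (fun T hT ↦ ?_) fun _ _ _ ↦ by positivity
    exact Finset.mem_filter.2 ⟨Finset.mem_univ T, (Finset.mem_powersetCard.1 hT).2.ge⟩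
  refine le_trans ?_ hle
  have heq : ∑ T ∈ Finset.powersetCard k (Finset.univ : Finset (Fin s)),
      p ^ T.card * (1 - p) ^ (s - T.card) = s.choose k * (p ^ k * (1 - p) ^ (s - k)) := by
    rw [Finset.sum_congr rfl fun T hT ↦ by rw [(Finset.mem_powersetCard.1 hT).2],
      Finset.sum_const, Finset.card_powersetCard, Finset.card_univ, Fintype.card_fin, nsmul_eq_mul]
  rw [heq]
  have hchoose : (s : ℝ) ^ k / (2 ^ k * k.factorial) ≤ s.choose k := by
    refine le_trans ?_ (Nat.pow_le_choose (α := ℝ) k s)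
    rw [← div_div, ← div_pow]
    gcongr
    have : ((s + 1 - k : ℕ) : ℝ) = s + 1 - k := by
      rw [Nat.cast_sub (by omega)]; push_cast; ring
    rw [this]
    have : (2 : ℝ) * k ≤ s := by exact_mod_cast hks
    linarith
  have hpow : 1 / 2 ≤ (1 - p) ^ (s - k) := by
    have h2 : (1 - p) ^ s ≤ (1 - p) ^ (s - k) :=
      pow_le_pow_of_le_one h1 (by linarith) (Nat.sub_le _ _)
    have h3 := one_add_mul_le_pow (a := -p) (by linarith [hp.2]) s
    rw [← sub_eq_add_neg] at h3
    linarith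
  calc (s * p) ^ k / (2 ^ (k + 1) * k.factorial)
      = (s : ℝ) ^ k / (2 ^ k * k.factorial) * (p ^ k * (1 / 2)) := by
        rw [mul_pow, pow_succ]; field_simp
    _ ≤ _ := by gcongr

/-- With `q` a lower bound for the probability that one block is dense and `B * q ≤ 1`, independence
gives at least `1 - (1 - q) ^ B ≥ B * q / 2`. -/
lemma IsResampledPair.le_measureReal_hasDenseBlock (h : IsResampledPair p ε P Y Z) {k : ℕ}
    (hp : p ∈ Set.Icc 0 1) (hks : 2 * k ≤ s) (hsp : s * p ≤ 1 / 2) (hB : B * (s * p) ^ k ≤ 1) :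
    B * (s * p) ^ k / (2 ^ (k + 2) * k.factorial) ≤ P.real {ω | HasDenseBlock k (Y ω)} := by
  have hY : Measurable Y := measurable_pi_iff.2 h.measurable_left
  set q := (s * p) ^ k / (2 ^ (k + 1) * k.factorial) with hq
  have h0 := hp.1
  have hq0 : 0 ≤ q := by positivity
  have hden : (1 : ℝ) ≤ 2 ^ (k + 1) * k.factorial := by
    have h1 : (1 : ℝ) ≤ 2 ^ (k + 1) := one_le_pow₀ (by norm_num)
    have h2 : (1 : ℝ) ≤ k.factorial := by exact_mod_cast k.factorial_pos
    nlinarith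
  have hqle : q ≤ (s * p) ^ k := div_le_self (by positivity) hden
  have hq1 : q ≤ 1 := by
    refine hqle.trans (pow_le_one₀ (by positivity) (by linarith))
  have hBq : B * q ≤ 1 := le_trans (by gcongr) hB
  have hsum := le_sum_filter_card_ge hp hks hsp
  rw [← hq] at hsum
  have hnot := h.measureReal_not_hasDenseBlock k
  have hcompl : P.real {ω | ¬ HasDenseBlock k (Y ω)} = 1 - P.real {ω | HasDenseBlock k (Y ω)} :=
    probReal_compl_eq_one_sub
      (hY (MeasurableSet.of_discrete (s := {x : Fin (B * s) → Bool | HasDenseBlock k x})))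
  have hbase : 0 ≤ 1 - ∑ T : Finset (Fin s) with k ≤ T.card,
      p ^ T.card * (1 - p) ^ (s - T.card) := by
    have h3 := Fin.sum_pow_mul_eq_add_pow (n := s) p (1 - p)
    rw [add_sub_cancel, one_pow] at h3
    refine sub_nonneg.2 (le_trans ?_ h3.le)
    have h1 : 0 ≤ 1 - p := by linarith [hp.2]
    exact Finset.sum_le_sum_of_subset_of_nonneg (Finset.filter_subset _ _)
      fun _ _ _ ↦ by positivity
  have hle : P.real {ω | ¬ HasDenseBlock k (Y ω)} ≤ (1 - q) ^ B := by
    rw [hnot]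
    exact pow_le_pow_left₀ hbase (by linarith) B
  -- Bernoulli bounds `1 + B * q` by `(1 + q) ^ B`, and `(1 - q) * (1 + q) ≤ 1`.
  have hprod : (1 - q) ^ B * (1 + B * q) ≤ 1 := by
    have h1 := one_add_mul_le_pow (a := q) (by linarith) B
    have h2 : 0 ≤ (1 - q) ^ B := pow_nonneg (by linarith) B
    calc (1 - q) ^ B * (1 + B * q) ≤ (1 - q) ^ B * (1 + q) ^ B := by gcongr
      _ = (1 - q ^ 2) ^ B := by rw [← mul_pow]; ring
      _ ≤ 1 := pow_le_one₀ (by nlinarith) (by nlinarith)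
  have hBq0 : 0 ≤ B * q := by positivity
  have hfin : (1 - q) ^ B ≤ 1 - B * q / 2 := by
    have h2 : 1 ≤ (1 - B * q / 2) * (1 + B * q) := by nlinarith
    have h3 : 0 < 1 + B * q := by linarith
    exact le_of_mul_le_mul_right (hprod.trans h2) h3
  have hgoal : B * (s * p) ^ k / (2 ^ (k + 2) * k.factorial) = B * q / 2 := by
    rw [hq, pow_succ 2 (k + 1)]; field_simp
  rw [hgoal]
  linarith

end Blocks

/-! ### The Boolean function: transitivity and sensitivity -/

section Function

variable {B s : ℕ}

open Classical in
/-- The function which is true if some block contains at least `r` ones, except that the parity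
of the total number of ones decides as soon as some block contains more than `r` ones. -/
noncomputable def denseBlockParity (B s r : ℕ) (x : Fin (B * s) → Bool) : Bool :=
  decide (HasDenseBlock r x ∧
    ¬ (HasDenseBlock (r + 1) x ∧ Odd (Finset.univ.filter fun i ↦ x i = true).card))

/-- Permuting the blocks and permuting positions simultaneously in all blocks preserve the function.
A transposition of each kind moves `i` to `j`. -/
lemma isTransitiveBoolFun_denseBlockParity (B s r : ℕ) :
    IsTransitiveBoolFun (denseBlockParity B s r) := by
  intro i j
  let τ := Equiv.swap (finProdFinEquiv.symm i).1 (finProdFinEquiv.symm j).1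
  let ρ := Equiv.swap (finProdFinEquiv.symm i).2 (finProdFinEquiv.symm j).2
  let σ : Equiv.Perm (Fin (B * s)) := finProdFinEquiv.permCongr (τ.prodCongr ρ)
  have hσ : ∀ b u, σ (finProdFinEquiv (b, u)) = finProdFinEquiv (τ b, ρ u) := fun b u ↦ by
    simp [σ, Equiv.permCongr_apply]
  refine ⟨σ, ?_, fun x ↦ ?_⟩
  · rw [← finProdFinEquiv.apply_symm_apply i, ← Prod.mk.eta (p := finProdFinEquiv.symm i), hσ]
    simp [τ, ρ, -finProdFinEquiv_symm_apply]
  · have hblock : ∀ b, (blockOnes (fun k ↦ x (σ k)) b).card = (blockOnes x (τ b)).card :=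
      fun b ↦ Finset.card_equiv ρ fun u ↦ by simp [blockOnes, hσ]
    have hdense : ∀ k, HasDenseBlock k (fun k ↦ x (σ k)) ↔ HasDenseBlock k x := fun k ↦ by
      simp only [HasDenseBlock, hblock]
      exact τ.exists_congr_left.trans (by simp)
    have htotal : (Finset.univ.filter fun i ↦ x (σ i) = true).card =
        (Finset.univ.filter fun i ↦ x i = true).card :=
      Finset.card_equiv σ fun u ↦ by simp
    exact decide_eq_decide.2 (by rw [hdense, hdense, htotal])

lemma denseBlockParity_eq_true_imp {r : ℕ} {x : Fin (B * s) → Bool}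
    (h : denseBlockParity B s r x = true) : HasDenseBlock r x := by
  classical
  exact (decide_eq_true_iff.1 h).1

lemma denseBlockParity_eq_true_iff {r : ℕ} {x : Fin (B * s) → Bool}
    (h : ¬ HasDenseBlock (r + 1) x) : denseBlockParity B s r x = true ↔ HasDenseBlock r x := by
  simp [denseBlockParity, h]

/-- Switching a coordinate on keeps a block with `r + 1` ones, so the parity decides at both points,
and it flips. -/
lemma denseBlockParity_ne {r : ℕ} {x y : Fin (B * s) → Bool} {i : Fin (B * s)}
    (hx : HasDenseBlock (r + 1) x) (hi : x i = false) (hy : y i = true)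
    (hxy : ∀ j, j ≠ i → y j = x j) : denseBlockParity B s r x ≠ denseBlockParity B s r y := by
  classical
  have hyd : HasDenseBlock (r + 1) y := by
    obtain ⟨b, T, hT, h⟩ := hasDenseBlock_iff_exists_subset.1 hx
    refine hasDenseBlock_iff_exists_subset.2 ⟨b, T, hT, fun j hj ↦ ?_⟩
    have := h j hj
    rw [hxy _ (fun h2 ↦ by rw [h2, hi] at this; simp at this), this]
  have hcard : (Finset.univ.filter fun i ↦ y i = true).card =
      (Finset.univ.filter fun i ↦ x i = true).card + 1 := by
    rw [← Finset.card_insert_of_notMem (a := i) (by simp [hi])]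
    congr 1
    ext j
    by_cases hj : j = i
    · subst hj; simp [hy]
    · simp [hj, hxy j hj]
  simp only [denseBlockParity, hx, hyd, hx.mono (Nat.le_succ r), hyd.mono (Nat.le_succ r), hcard,
    true_and, Nat.odd_add_one, ne_eq, decide_eq_decide]
  tauto

end Function

/-! ### Number of changes of the function along the walk -/

/-- Continuity from below along the increasing sets `⋂ m ≥ k, E m`. It transfers bounds uniform in
the grid to `numChanges`. -/
lemma measure_eventually_le {Ω : Type*} [MeasurableSpace Ω] {P : Measure Ω} {E : ℕ → Set Ω}
    {c : ℝ≥0∞} (h : ∀ m, 0 < m → P (E m) ≤ c) : P {ω | ∀ᶠ m in atTop, ω ∈ E m} ≤ c := by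
  have hset : {ω | ∀ᶠ m in atTop, ω ∈ E m} = ⋃ k : ℕ, ⋂ m ≥ k, E m := by
    ext ω
    simp [eventually_atTop]
  have hmono : Monotone fun k : ℕ ↦ ⋂ m ≥ k, E m := fun k l hkl ↦
    Set.biInter_mono (fun m hm ↦ le_trans hkl hm) fun _ _ ↦ subset_rfl
  rw [hset, hmono.measure_iUnion]
  refine iSup_le fun k ↦ (measure_mono ?_).trans (h (k + 1) k.succ_pos)
  exact Set.biInter_subset_of_mem (Nat.le_succ k)

section WalkOnBlocks

variable {B s : ℕ} {p : ℝ} {Ω : Type*} [MeasurableSpace Ω] {P : Measure Ω}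
  {X : ℝ≥0 → Ω → Fin (B * s) → Bool}

lemma lintegral_gridChanges {y : ℝ≥0 → Ω → Bool} (hy : ∀ t, Measurable (y t)) (M : ℕ) :
    ∫⁻ ω, (gridChanges M (fun t ↦ y t ω) : ℝ≥0∞) ∂P = ∑ j ∈ Finset.range M,
      P {ω | y ((j : ℝ≥0) / M) ω ≠ y (((j : ℝ≥0) + 1) / M) ω} := by
  have hm : ∀ j : ℕ, MeasurableSet {ω | y ((j : ℝ≥0) / M) ω ≠ y (((j : ℝ≥0) + 1) / M) ω} :=
    fun j ↦ (measurableSet_eq_fun (hy _) (hy _)).compl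
  have h1 : ∀ ω, (gridChanges M (fun t ↦ y t ω) : ℝ≥0∞) = ∑ j ∈ Finset.range M,
      {ω | y ((j : ℝ≥0) / M) ω ≠ y (((j : ℝ≥0) + 1) / M) ω}.indicator 1 ω := fun ω ↦ by
    simp [gridChanges, Set.indicator_apply]
  simp only [h1]
  rw [lintegral_finsetSum _ fun j _ ↦ measurable_one.indicator (hm j)]
  exact Finset.sum_congr rfl fun j _ ↦ lintegral_indicator_one (hm j)

variable [IsProbabilityMeasure P]

lemma IsBiasedWalk.isResampledPair_grid {n : ℕ} {X : ℝ≥0 → Ω → Fin n → Bool}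
    (hX : IsBiasedWalk p P X) (h0 : 0 ≤ p) (M j : ℕ) :
    IsResampledPair p (1 - Real.exp (-(M : ℝ)⁻¹)) P
      (X ((j : ℝ≥0) / M)) (X (((j : ℝ≥0) + 1) / M)) := by
  have h1 : (j : ℝ≥0) / M ≤ ((j : ℝ≥0) + 1) / M := by gcongr; exact le_self_add
  have := hX.isResampledPair h0 h1
  convert this using 4
  push_cast
  ring

lemma one_sub_exp_neg_mem (M : ℕ) : 1 - Real.exp (-(M : ℝ)⁻¹) ∈ Set.Icc 0 1 := by
  have h1 : Real.exp (-(M : ℝ)⁻¹) ≤ 1 := Real.exp_le_one_iff.2 (by simp)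
  exact ⟨by linarith, by linarith [Real.exp_pos (-(M : ℝ)⁻¹)]⟩

lemma mul_one_sub_exp_neg_le (M : ℕ) : M * (1 - Real.exp (-(M : ℝ)⁻¹)) ≤ 1 := by
  rcases Nat.eq_zero_or_pos M with rfl | hM
  · simp
  have hM' : (0 : ℝ) < M := by exact_mod_cast hM
  have h1 := Real.add_one_le_exp (-(M : ℝ)⁻¹)
  have h2 : 1 - Real.exp (-(M : ℝ)⁻¹) ≤ (M : ℝ)⁻¹ := by linarith
  calc M * (1 - Real.exp (-(M : ℝ)⁻¹)) ≤ M * (M : ℝ)⁻¹ := by gcongr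
    _ = 1 := mul_inv_cancel₀ hM'.ne'

lemma le_mul_one_sub_exp_neg {M : ℕ} (hM : 0 < M) :
    1 / 2 ≤ M * (1 - Real.exp (-(M : ℝ)⁻¹)) := by
  have hM' : (1 : ℝ) ≤ M := by exact_mod_cast hM
  have h1 := Real.add_one_le_exp ((M : ℝ)⁻¹)
  have h2 : Real.exp (-(M : ℝ)⁻¹) ≤ ((M : ℝ)⁻¹ + 1)⁻¹ := by
    rw [Real.exp_neg]
    exact inv_anti₀ (by positivity) h1
  have h3 : 1 - ((M : ℝ)⁻¹ + 1)⁻¹ = 1 / (1 + M) := by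
    field_simp
    ring
  have h4 : 1 / 2 ≤ (M : ℝ) * (1 / (1 + M)) := by
    rw [mul_one_div, div_le_div_iff₀ (by norm_num) (by linarith)]
    linarith
  refine h4.trans ?_
  gcongr
  linarith

lemma IsBiasedWalk.measurable {n : ℕ} {X : ℝ≥0 → Ω → Fin n → Bool} (hX : IsBiasedWalk p P X)
    (h0 : 0 ≤ p) (t : ℝ≥0) : Measurable (X t) :=
  measurable_pi_iff.2 (hX.isResampledPair h0 le_rfl).measurable_left

/-- Either a dense block is present at time `0`, which gives the summand `1`, or one appears in some
grid step. The `M` steps together cost at most `k * (B * (s * p) ^ k)`, because `M * (1 - exp (-1 /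
M)) ≤ 1`. -/
lemma IsBiasedWalk.measure_exists_grid_hasDenseBlock_le (hX : IsBiasedWalk p P X)
    (hp : p ∈ Set.Icc 0 1) (k M : ℕ) :
    P.real {ω | ∃ j ≤ M, HasDenseBlock k (X ((j : ℝ≥0) / M) ω)} ≤
      (k + 1) * (B * (s * p) ^ k) := by
  have hsub : {ω | ∃ j ≤ M, HasDenseBlock k (X ((j : ℝ≥0) / M) ω)} ⊆
      {ω | HasDenseBlock k (X 0 ω)} ∪ ⋃ j ∈ Finset.range M,
        {ω | HasDenseBlock k (X (((j : ℝ≥0) + 1) / M) ω) ∧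
          ¬ HasDenseBlock k (X ((j : ℝ≥0) / M) ω)} := by
    rintro ω ⟨j, hj, hd⟩
    by_contra hcon
    simp only [Set.mem_union, Set.mem_ofPred_eq, Set.mem_iUnion, Finset.mem_range, not_or,
      not_exists, not_and, not_not] at hcon
    obtain ⟨h0, hstep⟩ := hcon
    have hall : ∀ j ≤ M, ¬ HasDenseBlock k (X ((j : ℝ≥0) / M) ω) := by
      intro j
      induction j with
      | zero => simpa using h0
      | succ j ih =>
        intro hj h1
        exact ih (by omega) (hstep j (by omega) (by simpa using h1))
    exact hall j hj hd
  refine (measureReal_mono hsub (measure_ne_top _ _)).trans ((measureReal_union_le _ _).trans ?_)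
  have h1 := (hX.isResampledPair hp.1 (le_refl 0)).measureReal_hasDenseBlock_le hp.1 k
  have hε := one_sub_exp_neg_mem M
  have h2 : ∀ j ∈ Finset.range M, P.real {ω | HasDenseBlock k (X (((j : ℝ≥0) + 1) / M) ω) ∧
      ¬ HasDenseBlock k (X ((j : ℝ≥0) / M) ω)} ≤
        k * (B * (s * p) ^ k) * (1 - Real.exp (-(M : ℝ)⁻¹)) := fun j _ ↦
    (hX.isResampledPair_grid hp.1 M j).measureReal_hasDenseBlock_and_not_le hp hε.1 k
  have h3 := (measureReal_biUnion_finset_le (μ := P) (Finset.range M) _).trans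
    (Finset.sum_le_card_nsmul _ _ _ h2)
  rw [Finset.card_range, nsmul_eq_mul] at h3
  have h4 : 0 ≤ k * (B * (s * p) ^ k) := by have := hp.1; positivity
  have h5 := mul_le_mul_of_nonneg_left (mul_one_sub_exp_neg_le M) h4
  nlinarith

-- Markov's inequality for the number of changes on the grid, whose mean is bounded independently of
-- `M`.
open Classical in
lemma IsBiasedWalk.measure_le_gridChanges_hasDenseBlock_le (hX : IsBiasedWalk p P X)
    (hp : p ∈ Set.Icc 0 1) {k : ℕ} (hk : 0 < k) (r M : ℕ) :
    P.real {ω | k ≤ gridChanges M fun t ↦ decide (HasDenseBlock r (X t ω))} ≤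
      2 * (r * (B * (s * p) ^ r)) / k := by
  have hmeas : ∀ t, Measurable fun ω ↦ decide (HasDenseBlock r (X t ω)) := fun t ↦
    (Measurable.of_discrete (f := fun x : Fin (B * s) → Bool ↦ decide (HasDenseBlock r x))).comp
      (hX.measurable hp.1 t)
  have h1 := lintegral_gridChanges (P := P) hmeas M
  have h2 := meas_ge_le_lintegral_div (μ := P)
    (f := fun ω ↦ (gridChanges M (fun t ↦ decide (HasDenseBlock r (X t ω))) : ℝ≥0∞))
    (by
      simp only [gridChanges, Nat.cast_sum]
      refine (Finset.measurable_sum _ fun j _ ↦ ?_).aemeasurable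
      exact (Measurable.of_discrete (f := fun n : ℕ ↦ (n : ℝ≥0∞))).comp
        (Measurable.ite (measurableSet_eq_fun (hmeas _) (hmeas _)).compl measurable_const
          measurable_const))
    (ε := k) (by exact_mod_cast hk.ne') (by simp)
  rw [h1] at h2
  have h3 := ENNReal.toReal_mono (ENNReal.div_ne_top
    (ENNReal.sum_ne_top.2 fun j _ ↦ measure_ne_top P _) (by exact_mod_cast hk.ne')) h2
  rw [ENNReal.toReal_div, ENNReal.toReal_sum fun j _ ↦ measure_ne_top P _] at h3
  simp only [← measureReal_def, Nat.cast_le, ENNReal.toReal_natCast] at h3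
  refine h3.trans ?_
  gcongr
  have hε := one_sub_exp_neg_mem M
  have h4 : ∀ j ∈ Finset.range M, P.real {ω | decide (HasDenseBlock r (X ((j : ℝ≥0) / M) ω)) ≠
      decide (HasDenseBlock r (X (((j : ℝ≥0) + 1) / M) ω))} ≤
        2 * (r * (B * (s * p) ^ r) * (1 - Real.exp (-(M : ℝ)⁻¹))) := fun j _ ↦ by
    have := (hX.isResampledPair_grid hp.1 M j).measureReal_hasDenseBlock_ne_le hp hε.1 r
    simpa only [ne_eq, decide_eq_decide] using this
  refine (Finset.sum_le_card_nsmul _ _ _ h4).trans ?_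
  rw [Finset.card_range, nsmul_eq_mul]
  have h5 : 0 ≤ 2 * (r * (B * (s * p) ^ r)) := by have := hp.1; positivity
  have h6 := mul_le_mul_of_nonneg_left (mul_one_sub_exp_neg_le M) h5
  linarith

/-- The number of value changes of `denseBlockParity` is bounded in probability. -/
lemma IsBiasedWalk.measure_le_changeCount_le (hX : IsBiasedWalk p P X)
    (hp : p ∈ Set.Icc 0 1) {k : ℕ} (hk : 0 < k) (r : ℕ) :
    P {ω | (k : ℝ≥0∞) ≤ changeCount X (denseBlockParity B s r) ω} ≤
      ENNReal.ofReal (2 * (r * (B * (s * p) ^ r)) / k +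
        (r + 2) * (B * (s * p) ^ (r + 1))) := by
  classical
  simp only [changeCount, natCast_le_numChanges_iff]
  refine measure_eventually_le
    (E := fun M ↦ {ω | k ≤ gridChanges M fun t ↦ denseBlockParity B s r (X t ω)}) fun M hM ↦ ?_
  -- As long as no grid time shows a block with more than `r` ones, the parity rule is never used on
  -- the grid.
  have hsub : {ω | k ≤ gridChanges M fun t ↦ denseBlockParity B s r (X t ω)} ⊆
      {ω | k ≤ gridChanges M fun t ↦ decide (HasDenseBlock r (X t ω))} ∪
        {ω | ∃ j ≤ M, HasDenseBlock (r + 1) (X ((j : ℝ≥0) / M) ω)} := by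
    intro ω hω
    by_cases hd : ∃ j ≤ M, HasDenseBlock (r + 1) (X ((j : ℝ≥0) / M) ω)
    · exact Or.inr hd
    refine Or.inl ?_
    push Not at hd
    have heq : ∀ j ≤ M, denseBlockParity B s r (X ((j : ℝ≥0) / M) ω) =
        decide (HasDenseBlock r (X ((j : ℝ≥0) / M) ω)) := fun j hj ↦ by
      rw [Bool.eq_iff_iff, denseBlockParity_eq_true_iff (hd j hj), decide_eq_true_iff]
    have : gridChanges M (fun t ↦ denseBlockParity B s r (X t ω)) =
        gridChanges M fun t ↦ decide (HasDenseBlock r (X t ω)) := by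
      refine Finset.sum_congr rfl fun j hj ↦ ?_
      have hj' := Finset.mem_range.1 hj
      have h2 := heq (j + 1) hj'
      rw [Nat.cast_add, Nat.cast_one] at h2
      simp only [heq j hj'.le, h2]
    rw [Set.mem_ofPred_eq, ← this]
    exact hω
  rw [← ofReal_measureReal]
  refine ENNReal.ofReal_le_ofReal ?_
  refine (measureReal_mono hsub (measure_ne_top _ _)).trans ((measureReal_union_le _ _).trans ?_)
  have h1 := hX.measure_exists_grid_hasDenseBlock_le hp (r + 1) M
  have h2 := hX.measure_le_gridChanges_hasDenseBlock_le hp hk r M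
  push_cast at h1
  linarith

/-- The expected number of value changes of `denseBlockParity` is at least of the order of the
number of ones times the probability of having a block with more than `r` ones. -/
lemma IsBiasedWalk.le_lintegral_changeCount (hX : IsBiasedWalk p P X) (hp : p ∈ Set.Icc 0 1)
    (hn : 0 < B * s) (r : ℕ) {q : ℝ} (hpq : p ≤ q)
    (hq : ∀ t, q ≤ P.real {ω | HasDenseBlock (r + 1) (X t ω)}) :
    ENNReal.ofReal ((B * s : ℕ) * p * (q - p) / 6) ≤
      ∫⁻ ω, changeCount X (denseBlockParity B s r) ω ∂P := by
  -- A grid with `n = B * s` steps suffices: at mesh `1 / n` the probability `(1 - ε) ^ n` that no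
  -- clock rings in a step is exactly `exp (-1)`, so a step with a single update is not rare.
  have h1 : ∫⁻ ω, (gridChanges (B * s) (fun t ↦ denseBlockParity B s r (X t ω)) : ℝ≥0∞) ∂P ≤
      ∫⁻ ω, changeCount X (denseBlockParity B s r) ω ∂P := by
    refine lintegral_mono_ae ?_
    filter_upwards [hX.ae_rightContinuous (denseBlockParity B s r)] with ω hω
    exact gridChanges_le_numChanges hω hn
  refine le_trans ?_ h1
  rw [lintegral_gridChanges (y := fun t ω ↦ denseBlockParity B s r (X t ω)) fun t ↦
    (Measurable.of_discrete (f := denseBlockParity B s r)).comp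
    (hX.measurable hp.1 t)]
  obtain ⟨ε, hε_def⟩ : ∃ ε, ε = 1 - Real.exp (-((B * s : ℕ) : ℝ)⁻¹) := ⟨_, rfl⟩
  have hε : ε ∈ Set.Icc 0 1 := hε_def ▸ one_sub_exp_neg_mem (B * s)
  have hexp : (1 - ε) ^ (B * s) = Real.exp (-1) := by
    rw [hε_def, sub_sub_cancel, ← Real.exp_nat_mul]
    congr 1
    have : ((B * s : ℕ) : ℝ) ≠ 0 := by exact_mod_cast hn.ne'
    field_simp
  have hj : ∀ j ∈ Finset.range (B * s), ENNReal.ofReal ((B * s : ℕ) * (p * ε * Real.exp (-1) * (q - p))) ≤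
      P {ω | denseBlockParity B s r (X ((j : ℝ≥0) / (B * s : ℕ)) ω) ≠
        denseBlockParity B s r (X (((j : ℝ≥0) + 1) / (B * s : ℕ)) ω)} := by
    intro j _
    have h0 := hX.isResampledPair_grid hp.1 (B * s) j
    rw [← hε_def] at h0
    have h2 := h0.le_measureReal_ne hp hε
      (f := denseBlockParity B s r) (A := {x | HasDenseBlock (r + 1) x})
      fun x hx i hi y hy hxy ↦ denseBlockParity_ne hx hi hy hxy
    rw [Fintype.card_fin, hexp] at h2
    rw [← ofReal_measureReal]
    refine ENNReal.ofReal_le_ofReal (le_trans ?_ h2)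
    have := hp.1
    have := hε.1
    gcongr
    exact hq _
  refine le_trans ?_ (Finset.card_nsmul_le_sum _ _ _ hj)
  rw [Finset.card_range, ← ENNReal.ofReal_nsmul, nsmul_eq_mul]
  refine ENNReal.ofReal_le_ofReal ?_
  have h3 := le_mul_one_sub_exp_neg hn
  rw [← hε_def] at h3
  have h4 : 1 / 3 ≤ Real.exp (-1) := by
    rw [Real.exp_neg, one_div]
    exact inv_anti₀ (Real.exp_pos 1) (by linarith [Real.exp_one_lt_d9])
  have h5 : 0 ≤ (B * s : ℕ) * p * (q - p) := by
    have := hp.1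
    have : 0 ≤ q - p := by linarith
    positivity
  -- The constant is `1 / 2` from `n * ε` times `1 / 3` from `exp (-1)`.
  have h6 : 1 / 6 ≤ (B * s : ℕ) * ε * Real.exp (-1) := by nlinarith
  calc (B * s : ℕ) * p * (q - p) / 6 = (B * s : ℕ) * p * (q - p) * (1 / 6) := by ring
    _ ≤ (B * s : ℕ) * p * (q - p) * ((B * s : ℕ) * ε * Real.exp (-1)) := by gcongr
    _ = _ := by ring

end WalkOnBlocks

/-! ### Choice of block sizes and of the subsequence -/

section Parameters

lemma exists_nat_pow_tendsto {p : ℕ → ℝ} (hp : ∀ n, 1 ≤ n → 0 < p n ∧ p n < 1)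
    (hB : ∃ r : ℝ, 2 ≤ r ∧ Tendsto (fun n : ℕ ↦ (n : ℝ) * p n ^ r) atTop (𝓝 0)) :
    ∃ m : ℕ, 2 ≤ m ∧ Tendsto (fun n : ℕ ↦ (n : ℝ) * p n ^ (m + 1)) atTop (𝓝 0) := by
  obtain ⟨r, -, hr⟩ := hB
  refine ⟨max ⌈r⌉₊ 2, le_max_right _ _, ?_⟩
  refine tendsto_of_tendsto_of_tendsto_of_le_of_le' tendsto_const_nhds hr ?_ ?_
  · filter_upwards [eventually_ge_atTop 1] with n hn
    have := (hp n hn).1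
    positivity
  · filter_upwards [eventually_ge_atTop 1] with n hn
    have h0 := (hp n hn).1
    refine mul_le_mul_of_nonneg_left ?_ (Nat.cast_nonneg n)
    rw [← Real.rpow_natCast]
    refine Real.rpow_le_rpow_of_exponent_ge h0 (hp n hn).2.le ?_
    have h1 : r ≤ ⌈r⌉₊ := Nat.le_ceil r
    have h2 : (⌈r⌉₊ : ℝ) ≤ (max ⌈r⌉₊ 2 : ℕ) := by exact_mod_cast le_max_left _ _
    push_cast at h2 ⊢
    linarith

/-- Take the least `s` with `δ ≤ a * s ^ m`. As `a < δ` it is at least `2`, so `s ≤ 2 * (s - 1)`,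
and minimality at `s - 1` costs only a factor `2 ^ m`. -/
lemma exists_nat_mul_pow_mem_Icc {a δ : ℝ} (ha : 0 < a) (hδ : a < δ) {m : ℕ} (hm : m ≠ 0) :
    ∃ s : ℕ, 1 ≤ s ∧ δ ≤ a * s ^ m ∧ a * s ^ m ≤ 2 ^ m * δ := by
  classical
  have hex : ∃ s : ℕ, δ ≤ a * (s : ℝ) ^ m := by
    have : Tendsto (fun s : ℕ ↦ a * (s : ℝ) ^ m) atTop atTop :=
      ((tendsto_pow_atTop hm).comp tendsto_natCast_atTop_atTop).const_mul_atTop ha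
    exact (this.eventually_ge_atTop δ).exists
  obtain ⟨t, ht⟩ : ∃ t, Nat.find hex = t + 2 := by
    have h0 : Nat.find hex ≠ 0 := fun h ↦ by
      have := Nat.find_spec hex
      rw [h] at this
      simp [hm] at this
      linarith
    have h1 : Nat.find hex ≠ 1 := fun h ↦ by
      have := Nat.find_spec hex
      rw [h] at this
      simp at this
      linarith
    exact ⟨Nat.find hex - 2, by omega⟩
  refine ⟨t + 2, by omega, ht ▸ Nat.find_spec hex, ?_⟩
  have h1 : a * ((t + 1 : ℕ) : ℝ) ^ m < δ := not_le.1 (Nat.find_min hex (by omega))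
  calc a * ((t + 2 : ℕ) : ℝ) ^ m ≤ a * (2 * (t + 1 : ℕ)) ^ m := by
        gcongr
        push_cast
        linarith [(Nat.cast_nonneg t : (0 : ℝ) ≤ t)]
    _ = 2 ^ m * (a * ((t + 1 : ℕ) : ℝ) ^ m) := by rw [mul_pow]; ring
    _ ≤ 2 ^ m * δ := by gcongr

lemma tendsto_zero_of_pow {α : Type*} {l : Filter α} {x : α → ℝ} {m : ℕ} (hx : ∀ᶠ n in l, 0 ≤ x n)
    (h : Tendsto (fun n ↦ x n ^ m) l (𝓝 0)) : Tendsto x l (𝓝 0) := by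
  rw [Metric.tendsto_nhds]
  intro ε hε
  filter_upwards [hx, h.eventually_lt_const (pow_pos hε m)] with n h0 h1
  rw [Real.dist_eq, sub_zero, abs_of_nonneg h0]
  exact lt_of_pow_lt_pow_left₀ m hε.le h1

lemma tendsto_atTop_of_pow {α : Type*} {l : Filter α} {x : α → ℝ} {m : ℕ}
    (hx : ∀ᶠ n in l, 0 ≤ x n) (h : Tendsto (fun n ↦ x n ^ m) l atTop) : Tendsto x l atTop := by
  rw [tendsto_atTop]
  intro K
  filter_upwards [hx, h.eventually_gt_atTop (|K| ^ m)] with n h0 h1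
  exact (le_abs_self K).trans (lt_of_pow_lt_pow_left₀ m h0 h1).le

/-- Block sizes `s n` for which the expected number of `(m + 1)`-subsets of blocks that are full
of ones is of order one. -/
lemma exists_block_size {p : ℕ → ℝ} (hp : ∀ n, 1 ≤ n → 0 < p n ∧ p n < 1)
    (hA : Tendsto (fun n : ℕ ↦ (n : ℝ) * p n) atTop atTop) {m : ℕ} (hm : 2 ≤ m)
    (hB : Tendsto (fun n : ℕ ↦ (n : ℝ) * p n ^ (m + 1)) atTop (𝓝 0)) {δ : ℝ} (hδ : 0 < δ) :
    ∃ s : ℕ → ℕ, (∀ᶠ n in atTop, 1 ≤ s n ∧ δ ≤ n * p n ^ (m + 1) * s n ^ m ∧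
        n * p n ^ (m + 1) * s n ^ m ≤ 2 ^ m * δ) ∧
      Tendsto s atTop atTop ∧ Tendsto (fun n ↦ s n * p n) atTop (𝓝 0) ∧
      Tendsto (fun n ↦ (n * p n) * (s n * p n)) atTop atTop := by
  have hex : ∀ n : ℕ, ∃ s : ℕ, 0 < n * p n ^ (m + 1) → n * p n ^ (m + 1) < δ →
      1 ≤ s ∧ δ ≤ n * p n ^ (m + 1) * s ^ m ∧ n * p n ^ (m + 1) * s ^ m ≤ 2 ^ m * δ := by
    intro n
    by_cases h : 0 < n * p n ^ (m + 1) ∧ n * p n ^ (m + 1) < δ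
    · obtain ⟨s, hs⟩ := exists_nat_mul_pow_mem_Icc h.1 h.2 (m := m) (by omega)
      exact ⟨s, fun _ _ ↦ hs⟩
    · exact ⟨0, fun h1 h2 ↦ (h ⟨h1, h2⟩).elim⟩
  choose s hs using hex
  have hpos : ∀ᶠ n : ℕ in atTop, 0 < p n ∧ 0 < (n : ℝ) := by
    filter_upwards [eventually_ge_atTop 1] with n hn
    exact ⟨(hp n hn).1, by exact_mod_cast hn⟩
  have hmain : ∀ᶠ n in atTop, 1 ≤ s n ∧ δ ≤ n * p n ^ (m + 1) * s n ^ m ∧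
      n * p n ^ (m + 1) * s n ^ m ≤ 2 ^ m * δ := by
    filter_upwards [hpos, hB.eventually_lt_const hδ] with n hn h2
    have h0 := hn.1
    have h1 := hn.2
    exact hs n (by positivity) h2
  have hnonneg : ∀ᶠ n in atTop, 0 ≤ s n * p n := by
    filter_upwards [hpos] with n hn
    have := hn.1
    positivity
  refine ⟨s, hmain, ?_, ?_, ?_⟩
  · rw [tendsto_atTop]
    intro K
    -- A block size below `K` would make the product smaller than `δ`, since `n * p n ^ (m + 1)`
    -- tends to `0`.
    have hK : Tendsto (fun n : ℕ ↦ (n : ℝ) * p n ^ (m + 1) * (K : ℝ) ^ m) atTop (𝓝 0) := by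
      simpa using hB.mul_const ((K : ℝ) ^ m)
    filter_upwards [hmain, hpos, hK.eventually_lt_const hδ] with n h1 h2 h3
    by_contra! hlt
    have h4 : (s n : ℝ) ≤ K := by exact_mod_cast hlt.le
    have h5 : n * p n ^ (m + 1) * (s n : ℝ) ^ m ≤ n * p n ^ (m + 1) * (K : ℝ) ^ m := by
      have h6 := h2.1
      gcongr
    linarith [h1.2.1]
  · refine tendsto_zero_of_pow (m := m) hnonneg ?_
    refine tendsto_of_tendsto_of_tendsto_of_le_of_le' tendsto_const_nhds
      (hA.const_div_atTop (2 ^ m * δ)) ?_ ?_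
    · filter_upwards [hnonneg] with n hn
      positivity
    · filter_upwards [hmain, hpos] with n h1 h2
      have h3 := h2.1
      have h4 := h2.2
      rw [le_div_iff₀ (by positivity)]
      calc (s n * p n) ^ m * (n * p n) = n * p n ^ (m + 1) * s n ^ m := by ring
        _ ≤ _ := h1.2.2
  · refine tendsto_atTop_of_pow (m := m) ?_ ?_
    · filter_upwards [hnonneg, hpos] with n h1 h2
      have h3 := h2.1
      have h4 := h2.2
      positivity
    · refine tendsto_atTop_mono' _ ?_ (hA.const_mul_atTop hδ)
      filter_upwards [hmain, hpos, hA.eventually_ge_atTop 1] with n h1 h2 h3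
      -- Here `m ≥ 2` is essential: at least one factor `n * p n` is left over in `(n p · s p) ^ m =
      -- (n p ^ (m + 1) s ^ m) (n p) ^ (m - 1)`.
      obtain ⟨l, rfl⟩ : ∃ l, m = l + 2 := ⟨m - 2, by omega⟩
      have h4 : (n : ℝ) * p n ≤ (n * p n) ^ (l + 1) := le_self_pow₀ h3 (by omega)
      have h5 := h2.1
      calc δ * (n * p n) ≤ (n * p n ^ (l + 2 + 1) * s n ^ (l + 2)) * (n * p n) ^ (l + 1) := by
            gcongr
            exact h1.2.1
        _ = _ := by ring

/-- Replace `n` by `n / s n * s n`. Since `s n / n → 0`, this changes `n` and `p n` by factors of at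
most `2` eventually, and all the asymptotics survive. -/
lemma exists_block_parameters {p : ℕ → ℝ} (hp : ∀ n, 1 ≤ n → 0 < p n ∧ p n < 1)
    (hdecr : AntitoneOn p (Set.Ici 1))
    (hA : Tendsto (fun n : ℕ ↦ (n : ℝ) * p n) atTop atTop)
    (hB : ∃ r : ℝ, 2 ≤ r ∧ Tendsto (fun n : ℕ ↦ (n : ℝ) * p n ^ r) atTop (𝓝 0))
    (hC : ∀ φ : ℕ → ℕ, (∀ n, 1 ≤ n → 1 ≤ φ n) →
      Tendsto (fun n : ℕ ↦ |(n : ℝ) - (φ n : ℝ)| / min (n : ℝ) (φ n : ℝ)) atTop (𝓝 0) →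
      Tendsto (fun n : ℕ ↦ p n / p (φ n)) atTop (𝓝 1)) :
    ∃ r : ℕ, ∃ c : ℝ, 0 < c ∧ ∃ B s : ℕ → ℕ, StrictMono (fun i ↦ B i * s i) ∧
      (∀ i, 1 ≤ B i * s i) ∧
      (∀ i, c ≤ B i * (s i * p (B i * s i)) ^ r ∧ B i * (s i * p (B i * s i)) ^ r ≤ 1 / 2) ∧
      Tendsto s atTop atTop ∧ Tendsto (fun i ↦ s i * p (B i * s i)) atTop (𝓝 0) ∧
      Tendsto (fun i ↦ ((B i * s i : ℕ) * p (B i * s i)) * (s i * p (B i * s i)))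
        atTop atTop := by
  obtain ⟨m, hm, hBm⟩ := exists_nat_pow_tendsto hp hB
  -- This `δ` absorbs two losses, `2 ^ m` from rounding the block size and `2 ^ (m + 1)` from
  -- replacing `p n` by its value at the rounded index, and leaves `1 / 2` as the upper bound.
  obtain ⟨s, hs, hs_top, hsp, hnsp⟩ :=
    exists_block_size hp hA hm hBm (δ := 1 / 4 ^ (m + 1)) (by positivity)
  have hsn : Tendsto (fun n : ℕ ↦ (s n : ℝ) / n) atTop (𝓝 0) := by
    refine tendsto_of_tendsto_of_tendsto_of_le_of_le' tendsto_const_nhds hsp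
      (Eventually.of_forall fun n ↦ by positivity) ?_
    filter_upwards [eventually_ge_atTop 1, hA.eventually_ge_atTop 1] with n hn h1
    have hn' : (0 : ℝ) < n := by exact_mod_cast hn
    rw [div_le_iff₀ hn']
    calc (s n : ℝ) ≤ s n * (n * p n) := le_mul_of_one_le_right (Nat.cast_nonneg _) h1
      _ = _ := by ring
  have hfloor : ∀ᶠ n : ℕ in atTop, 1 ≤ n / s n * s n ∧ n / s n * s n ≤ n ∧
      (n : ℝ) / 2 ≤ (n / s n * s n : ℕ) ∧ (n : ℝ) - (n / s n * s n : ℕ) ≤ s n := by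
    filter_upwards [eventually_ge_atTop 1, hsn.eventually_lt_const (by norm_num : (0 : ℝ) < 1 / 2),
      hs] with n hn h1 h2
    have hn' : (0 : ℝ) < n := by exact_mod_cast hn
    rw [div_lt_iff₀ hn'] at h1
    have h3 : n < n / s n * s n + s n := Nat.lt_div_mul_add (by omega)
    have h4 : (n : ℝ) < (n / s n * s n : ℕ) + s n := by exact_mod_cast h3
    have h5 : (n : ℝ) / 2 ≤ (n / s n * s n : ℕ) := by linarith
    refine ⟨?_, Nat.div_mul_le_self _ _, h5, by linarith⟩
    have h6 : (0 : ℝ) < (n / s n * s n : ℕ) := by linarith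
    exact_mod_cast h6
  have hratio : ∀ᶠ n in atTop, p (n / s n * s n) ≤ 2 * p n := by
    -- The maximum with `1` only ensures positivity at the finitely many indices where the rounded
    -- value might vanish.
    have hφ := hC (fun n ↦ max 1 (n / s n * s n)) (fun n _ ↦ le_max_left _ _) ?_
    · filter_upwards [hφ.eventually_const_lt (by norm_num : (1 / 2 : ℝ) < 1), hfloor] with n h1 h2
      rw [max_eq_right h2.1, lt_div_iff₀ (hp _ h2.1).1] at h1
      linarith
    · have h2 : Tendsto (fun n : ℕ ↦ 2 * ((s n : ℝ) / n)) atTop (𝓝 0) := by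
        simpa using hsn.const_mul 2
      refine tendsto_of_tendsto_of_tendsto_of_le_of_le' tendsto_const_nhds h2
        (Eventually.of_forall fun n ↦ by positivity) ?_
      filter_upwards [hfloor, eventually_ge_atTop 1] with n h3 hn
      have hn' : (0 : ℝ) < n := by exact_mod_cast hn
      have h4 : ((n / s n * s n : ℕ) : ℝ) ≤ n := by exact_mod_cast h3.2.1
      rw [max_eq_right h3.1, min_eq_right h4, abs_of_nonneg (by linarith)]
      calc ((n : ℝ) - (n / s n * s n : ℕ)) / (n / s n * s n : ℕ) ≤ s n / (n / 2) := by
            gcongr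
            · exact h3.2.2.2
            · exact h3.2.2.1
        _ = _ := by field_simp
  have hmain : ∀ᶠ n in atTop, 1 ≤ n / s n * s n ∧
      1 / (2 * 4 ^ (m + 1)) ≤ (n / s n : ℕ) * (s n * p (n / s n * s n)) ^ (m + 1) ∧
      (n / s n : ℕ) * (s n * p (n / s n * s n)) ^ (m + 1) ≤ 1 / 2 ∧
      p n ≤ p (n / s n * s n) ∧ p (n / s n * s n) ≤ 2 * p n ∧
      (n : ℝ) / 2 ≤ (n / s n * s n : ℕ) ∧ 0 < p n := by
    filter_upwards [hfloor, hratio, hs, eventually_ge_atTop 1] with n h1 h2 h3 hn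
    have hle : p n ≤ p (n / s n * s n) := hdecr h1.1 hn h1.2.1
    have h0 := (hp n hn).1
    have h4 : ((n / s n * s n : ℕ) : ℝ) ≤ n := by exact_mod_cast h1.2.1
    have heq : ((n / s n : ℕ) : ℝ) * (s n * p (n / s n * s n)) ^ (m + 1) =
        (n / s n * s n : ℕ) * p (n / s n * s n) ^ (m + 1) * s n ^ m := by
      push_cast
      ring
    refine ⟨h1.1, ?_, ?_, hle, h2, h1.2.2.1, h0⟩
    · rw [heq]
      calc (1 : ℝ) / (2 * 4 ^ (m + 1)) = 1 / 4 ^ (m + 1) / 2 := by field_simp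
        _ ≤ n * p n ^ (m + 1) * s n ^ m / 2 := by gcongr; exact h3.2.1
        _ = n / 2 * p n ^ (m + 1) * s n ^ m := by ring
        _ ≤ _ := by
          gcongr
          exact h1.2.2.1
    · rw [heq]
      have h5 : 0 ≤ p (n / s n * s n) := h0.le.trans hle
      calc ((n / s n * s n : ℕ) : ℝ) * p (n / s n * s n) ^ (m + 1) * s n ^ m
          ≤ n * (2 * p n) ^ (m + 1) * s n ^ m := by gcongr
        _ = 2 ^ (m + 1) * (n * p n ^ (m + 1) * s n ^ m) := by rw [mul_pow]; ring
        _ ≤ 2 ^ (m + 1) * (2 ^ m * (1 / 4 ^ (m + 1))) :=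
          mul_le_mul_of_nonneg_left h3.2.2 (by positivity)
        _ = 1 / 2 := by
          have : (4 : ℝ) ^ (m + 1) = 2 ^ (m + 1) * 2 ^ m * 2 := by
            rw [mul_assoc, ← pow_succ, ← mul_pow]; norm_num
          rw [this]
          field_simp
  obtain ⟨n₀, hn₀⟩ := eventually_atTop.1 hmain
  have hshift : Tendsto (fun k : ℕ ↦ k + n₀) atTop atTop := tendsto_add_atTop_nat n₀
  have hBs : Tendsto (fun n ↦ n / s n * s n) atTop atTop := by
    rw [← tendsto_natCast_atTop_iff (R := ℝ)]
    refine tendsto_atTop_mono' _ (hmain.mono fun n h ↦ h.2.2.2.2.2.1) ?_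
    exact tendsto_natCast_atTop_atTop.atTop_div_const (by norm_num)
  -- The rounded dimensions need not be monotone in `n`, so a subsequence makes them strictly
  -- increasing.
  obtain ⟨ψ, hψ, hψν⟩ := strictMono_subseq_of_tendsto_atTop (hBs.comp hshift)
  have hlim : Tendsto (fun i ↦ ψ i + n₀) atTop atTop := hshift.comp hψ.tendsto_atTop
  have hi : ∀ i, n₀ ≤ ψ i + n₀ := fun i ↦ Nat.le_add_left _ _
  refine ⟨m + 1, 1 / (2 * 4 ^ (m + 1)), by positivity, fun i ↦ (ψ i + n₀) / s (ψ i + n₀),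
    fun i ↦ s (ψ i + n₀), hψν, fun i ↦ (hn₀ _ (hi i)).1,
    fun i ↦ ⟨(hn₀ _ (hi i)).2.1, (hn₀ _ (hi i)).2.2.1⟩, hs_top.comp hlim, ?_, ?_⟩
  · have h1 : Tendsto (fun n ↦ s n * p (n / s n * s n)) atTop (𝓝 0) := by
      have h2 : Tendsto (fun n ↦ 2 * (s n * p n)) atTop (𝓝 0) := by simpa using hsp.const_mul 2
      refine tendsto_of_tendsto_of_tendsto_of_le_of_le' tendsto_const_nhds h2 ?_ ?_
      · filter_upwards [hmain] with n h
        have : 0 ≤ p (n / s n * s n) := h.2.2.2.2.2.2.le.trans h.2.2.2.1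
        positivity
      · filter_upwards [hmain] with n h
        calc s n * p (n / s n * s n) ≤ s n * (2 * p n) := by gcongr; exact h.2.2.2.2.1
          _ = _ := by ring
    exact h1.comp hlim
  · have h1 : Tendsto (fun n ↦ ((n / s n * s n : ℕ) * p (n / s n * s n)) *
        (s n * p (n / s n * s n))) atTop atTop := by
      refine tendsto_atTop_mono' _ ?_ (hnsp.const_mul_atTop (by norm_num : (0 : ℝ) < 1 / 2))
      filter_upwards [hmain] with n h
      have h0 := h.2.2.2.2.2.2
      have h2 := h.2.2.2.1
      have h4 := h.2.2.2.2.2.1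
      have h5 := h0.le.trans h2
      calc 1 / 2 * ((n * p n) * (s n * p n)) = (n / 2 * p n) * (s n * p n) := by ring
        _ ≤ _ := by
          refine mul_le_mul (mul_le_mul h4 h2 h0.le (by positivity)) ?_ (by positivity)
            (by positivity)
          gcongr
    exact h1.comp hlim

end Parameters

/-! ### Non-degeneracy and conclusion -/

section Limits

variable {p : ℝ} {Ω : Type*} [MeasurableSpace Ω] {P : Measure Ω} [IsProbabilityMeasure P]

lemma IsBiasedWalk.measure_denseBlockParity_le {B s r : ℕ} {X : ℝ≥0 → Ω → Fin (B * s) → Bool}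
    (hX : IsBiasedWalk p P X) (h0 : 0 ≤ p) (t : ℝ≥0) :
    P {ω | denseBlockParity B s r (X t ω) = true} ≤ ENNReal.ofReal (B * (s * p) ^ r) := by
  rw [← ofReal_measureReal]
  refine ENNReal.ofReal_le_ofReal ?_
  refine le_trans (measureReal_mono ?_ (measure_ne_top _ _))
    ((hX.isResampledPair h0 (le_refl t)).measureReal_hasDenseBlock_le h0 r)
  exact fun ω hω ↦ denseBlockParity_eq_true_imp hω

/-- The function can fail to be true at a point with a block of `r` ones only if some block has `r +
1` ones, which accounts for the subtracted term. -/
lemma IsBiasedWalk.le_measure_denseBlockParity {B s r : ℕ} {X : ℝ≥0 → Ω → Fin (B * s) → Bool}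
    (hX : IsBiasedWalk p P X) (hp : p ∈ Set.Icc 0 1) (hrs : 2 * r ≤ s) (hsp : s * p ≤ 1 / 2)
    (hB : B * (s * p) ^ r ≤ 1) (t : ℝ≥0) :
    ENNReal.ofReal (B * (s * p) ^ r / (2 ^ (r + 2) * r.factorial) - B * (s * p) ^ (r + 1)) ≤
      P {ω | denseBlockParity B s r (X t ω) = true} := by
  rw [← ofReal_measureReal]
  refine ENNReal.ofReal_le_ofReal ?_
  have h := hX.isResampledPair hp.1 (le_refl t)
  have h1 := h.le_measureReal_hasDenseBlock hp hrs hsp hB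
  have h2 := h.measureReal_hasDenseBlock_le hp.1 (r + 1)
  have hsub : {ω | HasDenseBlock r (X t ω)} ⊆
      {ω | denseBlockParity B s r (X t ω) = true} ∪ {ω | HasDenseBlock (r + 1) (X t ω)} := by
    intro ω hω
    by_cases hd : HasDenseBlock (r + 1) (X t ω)
    · exact Or.inr hd
    · exact Or.inl ((denseBlockParity_eq_true_iff hd).2 hω)
  have h3 := (measureReal_mono hsub (measure_ne_top P _)).trans (measureReal_union_le _ _)
  linarith

end Limits

theorem theorem1 (p : ℕ → ℝ)
    (hp : ∀ n, 1 ≤ n → 0 < p n ∧ p n < 1)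
    (hdecr : AntitoneOn p (Set.Ici 1))
    (hA : Tendsto (fun n : ℕ ↦ (n : ℝ) * p n) atTop atTop)
    (hB : ∃ r : ℝ, 2 ≤ r ∧ Tendsto (fun n : ℕ ↦ (n : ℝ) * p n ^ r) atTop (𝓝 0))
    (hC : ∀ φ : ℕ → ℕ, (∀ n, 1 ≤ n → 1 ≤ φ n) →
      Tendsto (fun n : ℕ ↦ |(n : ℝ) - (φ n : ℝ)| / min (n : ℝ) (φ n : ℝ)) atTop (𝓝 0) →
      Tendsto (fun n : ℕ ↦ p n / p (φ n)) atTop (𝓝 1)) :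
    ∃ ν : ℕ → ℕ, StrictMono ν ∧ (∀ i, 1 ≤ ν i) ∧
      ∃ f : ∀ i, (Fin (ν i) → Bool) → Bool,
        (∀ i, IsTransitiveBoolFun (f i)) ∧
        ∀ (Ω : ℕ → Type*) [∀ n, MeasurableSpace (Ω n)] (P : ∀ n, Measure (Ω n))
          [∀ n, IsProbabilityMeasure (P n)] (X : ∀ n, ℝ≥0 → Ω n → Fin n → Bool),
          (∀ n, 1 ≤ n → IsBiasedWalk (p n) (P n) (X n)) →
            IsNondegenerateSeq ν f P X ∧
            IsTameSeq ν f P X ∧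
            Tendsto (fun i ↦ ∫⁻ ω, changeCount (X (ν i)) (f i) ω ∂(P (ν i))) atTop (𝓝 ∞) := by
  obtain ⟨r, c, hc, B, s, hmono, hpos, hBr, hs, hsp, hnsp⟩ :=
    exists_block_parameters hp hdecr hA hB hC
  have hp' : ∀ i, p (B i * s i) ∈ Set.Icc 0 1 := fun i ↦
    ⟨(hp _ (hpos i)).1.le, (hp _ (hpos i)).2.le⟩
  have hsmall : ∀ i, B i * (s i * p (B i * s i)) ^ (r + 1) ≤ s i * p (B i * s i) := fun i ↦ by
    have h0 := (hp' i).1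
    rw [pow_succ, ← mul_assoc]
    refine mul_le_of_le_one_left (by positivity) ((hBr i).2.trans (by norm_num))
  refine ⟨fun i ↦ B i * s i, hmono, hpos, fun i ↦ denseBlockParity (B i) (s i) r,
    fun i ↦ isTransitiveBoolFun_denseBlockParity _ _ _, fun Ω _ P _ X hX ↦ ?_⟩
  have hX' : ∀ i, IsBiasedWalk (p (B i * s i)) (P (B i * s i)) (X (B i * s i)) :=
    fun i ↦ hX _ (hpos i)
  refine ⟨⟨?_, ?_⟩, ?_, ?_⟩
  · set K : ℝ := 2 ^ (r + 2) * r.factorial with hK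
    have hK0 : 0 < K := by positivity
    have hcK : 0 < c / K := by positivity
    refine lt_of_lt_of_le (b := ENNReal.ofReal (c / K / 2)) (by simpa using hcK) ?_
    refine le_liminf_of_le (by isBoundedDefault) ?_
    filter_upwards [hs.eventually_ge_atTop (2 * r),
      hsp.eventually_lt_const (by norm_num : (0 : ℝ) < 1 / 2),
      hsp.eventually_lt_const (half_pos hcK)] with i h1 h2 h3
    refine le_trans (ENNReal.ofReal_le_ofReal ?_) ((hX' i).le_measure_denseBlockParity (hp' i) h1
      h2.le ((hBr i).2.trans (by norm_num)) 0)
    have h4 : c / K ≤ B i * (s i * p (B i * s i)) ^ r / K := by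
      gcongr
      exact (hBr i).1
    rw [← hK]
    linarith [hsmall i]
  · refine lt_of_le_of_lt (b := ENNReal.ofReal (1 / 2)) ?_
      (ENNReal.ofReal_lt_one.2 (by norm_num))
    refine limsup_le_of_le (by isBoundedDefault) (Eventually.of_forall fun i ↦ ?_)
    exact ((hX' i).measure_denseBlockParity_le (hp' i).1 0).trans
      (ENNReal.ofReal_le_ofReal (hBr i).2)
  · intro ε hε
    obtain ⟨η, hη, hηε⟩ : ∃ η : ℝ, 0 < η ∧ ENNReal.ofReal η < ε := by
      obtain ⟨η, -, h1, h2⟩ := ENNReal.lt_iff_exists_real_btwn.1 hε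
      exact ⟨η, ENNReal.ofReal_pos.1 h1, h2⟩
    -- Half of `η` pays for the Markov bound, which is at most `r / (k + 1)`, and half for the
    -- exceptional event, of order `s * p`.
    obtain ⟨k, hk⟩ := exists_nat_gt (2 * r / η)
    have hk' : (0 : ℝ) < k + 1 := by positivity
    have hrk : (r : ℝ) / (k + 1) ≤ η / 2 := by
      rw [div_lt_iff₀ hη] at hk
      rw [div_le_iff₀ hk']
      nlinarith
    have hlim : Tendsto (fun i ↦ (r + 2) * (s i * p (B i * s i))) atTop (𝓝 0) := by
      simpa using hsp.const_mul ((r : ℝ) + 2)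
    obtain ⟨i₀, hi₀⟩ := eventually_atTop.1 (hlim.eventually_lt_const (half_pos hη))
    refine ⟨k + 1, by omega, B i₀ * s i₀, hpos i₀, fun i hi ↦ ?_⟩
    have hii : i₀ ≤ i := hmono.le_iff_le.1 hi
    refine lt_of_le_of_lt ?_ hηε
    refine ((hX' i).measure_le_changeCount_le (hp' i) k.succ_pos r).trans
      (ENNReal.ofReal_le_ofReal ?_)
    have h1 : 2 * (r * (B i * (s i * p (B i * s i)) ^ r)) / (k + 1 : ℕ) ≤ r / (k + 1) := by
      push_cast
      gcongr
      have := mul_le_mul_of_nonneg_left (hBr i).2 (Nat.cast_nonneg (α := ℝ) r)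
      linarith
    have h2 : (r + 2) * (B i * (s i * p (B i * s i)) ^ (r + 1)) ≤
        (r + 2) * (s i * p (B i * s i)) :=
      mul_le_mul_of_nonneg_left (hsmall i) (by positivity)
    linarith [hi₀ i hii]
  · set K : ℝ := 2 ^ (r + 1 + 2) * (r + 1).factorial with hK
    have hK0 : 0 < K := by positivity
    have hcK : 0 < c / K := by positivity
    have hlim := ENNReal.tendsto_ofReal_atTop.comp
      (hnsp.const_mul_atTop (by positivity : 0 < c / K / 12))
    refine tendsto_nhds_top_mono hlim ?_
    filter_upwards [hs.eventually_ge_atTop (2 * (r + 1)),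
      hsp.eventually_lt_const (by norm_num : (0 : ℝ) < 1 / 2),
      (tendsto_natCast_atTop_atTop (R := ℝ)).comp hs |>.eventually_ge_atTop (2 / (c / K))]
      with i h1 h2 h3
    have h0 := (hp' i).1
    have hq : c / K * (s i * p (B i * s i)) ≤
        B i * (s i * p (B i * s i)) ^ (r + 1) / K := by
      calc c / K * (s i * p (B i * s i)) = c * (s i * p (B i * s i)) / K := by ring
        _ ≤ B i * (s i * p (B i * s i)) ^ r * (s i * p (B i * s i)) / K := by
          gcongr
          exact (hBr i).1
        _ = _ := by ring
    -- As `s i → ∞`, the loss `p` in `q - p` is eventually at most half of the lower bound `q = c /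
    -- K * (s * p)` for the exceptional event.
    have hpq : 2 * p (B i * s i) ≤ c / K * (s i * p (B i * s i)) := by
      rw [Function.comp_apply, div_le_iff₀ hcK] at h3
      nlinarith
    refine le_trans (ENNReal.ofReal_le_ofReal ?_) ((hX' i).le_lintegral_changeCount (hp' i)
      (hpos i) r (q := c / K * (s i * p (B i * s i))) (by linarith) fun t ↦ hq.trans ?_)
    · have h4 : 0 ≤ ((B i * s i : ℕ) : ℝ) * p (B i * s i) := by positivity
      have h5 : c / K * (s i * p (B i * s i)) / 2 ≤
          c / K * (s i * p (B i * s i)) - p (B i * s i) := by linarith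
      have h6 := mul_le_mul_of_nonneg_left h5 h4
      linarith
    · refine ((hX' i).isResampledPair h0 (le_refl t)).le_measureReal_hasDenseBlock (hp' i) h1
        h2.le ?_
      linarith [hsmall i]
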